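/- All Hilbert spaces are finite-dimensional. Let $A,B,R_A,R_B,A',B'$ be quantum systems with $\mathcal H_A\otimes\mathcal H_B\cong\mathcal H_{A'}\otimes\mathcal H_{B'}$, let $|\psi\rangle\in\mathcal H_A\otimes\mathcal H_{R_A}$ and $|\phi\rangle\in\mathcal H_B\otimes\mathcal H_{R_B}$ be unit vectors, and put $\rho_{AR_A}=|\psi\rangle\langle\psi|$, $\rho_{BR_B}=|\phi\rangle\langle\phi|$, $\rho_A=\mathrm{Tr}_{R_A}\rho_{AR_A}$, $\rho_B=\mathrm{Tr}_{R_B}\rho_{BR_B}$. Let $X_A,X_B,X_{A'},X_{B'}$ be Hermitian operators on $A,B,A',B'$, and let $U$ be a unitary operator from $\mathcal H_A\otimes\mathcal H_B$ onto $\mathcal H_{A'}\otimes\mathcal H_{B'}$ (a unitary on $AB$, whose space is then divided as $A'B'$) satisfying the conservation law $$U(X_A\otimes 1+1\otimes X_B)U^\dagger=X_{A'}\otimes 1+1\otimes X_{B'} .$$ For density operators let $F(\rho,\sigma)=\mathrm{Tr}\sqrt{\sqrt\sigma\rho\sqrt\sigma}$ and $D_F(\rho,\sigma)=\sqrt{1-F(\rho,\sigma)^2}$.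 Define: - the recovery error $$\delta=\min_{\mathcal R}D_F\big(\rho_{AR_A},(\mathrm{id}_{R_A}\otimes\mathcal R)[\mathrm{Tr}_{B'}(U(\rho_{AR_A}\otimes\rho_{BR_B})U^\dagger)]\big),$$ the minimum being over all completely positive trace-preserving maps $\mathcal R$ from operators on $A'R_B$ to operators on $A$ (and $U$ acting trivially on $R_AR_B$); - the dynamical fluctuation $$\mathcal A=\max_{\{p_j,\rho_j\}}\sum_jp_j|\Delta_j|,\qquad \Delta_j=\big(\mathrm{Tr}[X_A\rho_j]-\mathrm{Tr}[X_{A'}\mathcal E(\rho_j)]\big)-\big(\mathrm{Tr}[X_A\rho_A]-\mathrm{Tr}[X_{A'}\mathcal E(\rho_A)]\big),$$ where $\mathcal E(\xi)=\mathrm{Tr}_{B'}[U(\xi\otimes\rho_B)U^\dagger]$ and the maximum is over all finite decompositions $\rho_A=\sum_jp_j\rho_j$ into density operators $\rho_j$ with $p_j\ge0$, $\sum_jp_j=1$; - the quantum Fisher information of $X=X_B\otimes1_{R_B}$ in $\rho_{BR_B}$, $$\mathcal F=4\lim_{\epsilon\to0}\frac{D_F(e^{-iX\epsilon}\rho_{BR_B}e^{iX\epsilon},\rho_{BR_B})^2}{\epsilon^2};$$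 - $\Delta_+=(\mathcal D_{X_A}+\mathcal D_{X_{A'}})/2$, where $\mathcal D_X$ is the difference between the maximum and the minimum eigenvalue of $X$. Then the maximum, the limit and the minimum in these definitions exist, and $$\frac{\mathcal A}{2(\sqrt{\mathcal F}+4\Delta_+)}\le\delta ,$$ where the left-hand side is read as $0$ if its denominator vanishes. -/

import Mathlib

open Filter Topology
open scoped Matrix Kronecker MatrixOrder ComplexOrder

/-! A finite-dimensional quantum system is given by a finite index set `n` of an orthonormal basis
of its Hilbert space; operators are matrices `Matrix n n ℂ`, and the composite of the systems
`m` and `n` is `m × n`. -/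

noncomputable section

namespace QRecovery

/-- Density operators: positive semidefinite matrices of unit trace. -/
def IsDensity {n : Type*} [Fintype n] (ρ : Matrix n n ℂ) : Prop :=
  ρ.PosSemidef ∧ ρ.trace = 1

/-- The rank-one operator `|ψ⟩⟨ψ|`. -/
def pureState {n : Type*} (ψ : EuclideanSpace ℂ n) : Matrix n n ℂ :=
  Matrix.of fun i j => ψ i * star (ψ j)

/-- The partial trace over the second factor. -/
def traceSnd {m n : Type*} [Fintype n] (M : Matrix (m × n) (m × n) ℂ) : Matrix m m ℂ :=
  Matrix.of fun i j => ∑ k, M (i, k) (j, k)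

/-- The expectation value `⟨X⟩_ρ = Tr (X ρ)` (real for Hermitian `X` and `ρ`). -/
def expect {n : Type*} [Fintype n] (X ρ : Matrix n n ℂ) : ℝ :=
  (X * ρ).trace.re

/-- The difference between the maximum and the minimum eigenvalue of a Hermitian matrix. -/
def eigenvalueSpread {n : Type*} [Fintype n] [DecidableEq n] {X : Matrix n n ℂ}
    (hX : X.IsHermitian) : ℝ :=
  (⨆ i, hX.eigenvalues i) - ⨅ i, hX.eigenvalues i

/-- Uhlmann's fidelity `F(ρ, σ) = Tr √(√σ ρ √σ)`. -/
def fidelity {n : Type*} [Fintype n] [DecidableEq n] (ρ σ : Matrix n n ℂ) : ℝ :=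
  (CFC.sqrt (CFC.sqrt σ * ρ * CFC.sqrt σ)).trace.re

/-- The purified distance `D_F(ρ, σ) = √(1 - F(ρ, σ)²)`. -/
def purifiedDistance {n : Type*} [Fintype n] [DecidableEq n] (ρ σ : Matrix n n ℂ) : ℝ :=
  Real.sqrt (1 - fidelity ρ σ ^ 2)

/-- The quotient `4 D_F(e^{-iXε} ρ e^{iXε}, ρ)² / ε²`. -/
def fisherQuotient {n : Type*} [Fintype n] [DecidableEq n] (ρ X : Matrix n n ℂ) (ε : ℝ) : ℝ :=
  4 * purifiedDistance
    (NormedSpace.exp (-(Complex.I * (ε : ℂ)) • X) * ρ *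
      NormedSpace.exp ((Complex.I * (ε : ℂ)) • X)) ρ ^ 2 / ε ^ 2

/-- The quantum Fisher information
`𝓕_ρ(X) = 4 lim_{ε → 0} D_F(e^{-iXε} ρ e^{iXε}, ρ)² / ε²`. -/
def fisherInfo {n : Type*} [Fintype n] [DecidableEq n] (ρ X : Matrix n n ℂ) : ℝ :=
  limUnder (𝓝[≠] (0 : ℝ)) (fisherQuotient ρ X)

/-- The map `Φ ⊗ id_r`, for a linear map `Φ` from operators on `n` to operators on `m`. -/
def tensorId {n m : Type*} (r : Type*) (Φ : Matrix n n ℂ →ₗ[ℂ] Matrix m m ℂ)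
    (M : Matrix (n × r) (n × r) ℂ) : Matrix (m × r) (m × r) ℂ :=
  Matrix.of fun x y => Φ (Matrix.of fun a b => M (a, x.2) (b, y.2)) x.1 y.1

/-- Completely positive and trace preserving (CPTP) maps. -/
structure IsChannel {n m : Type*} [Fintype n] [Fintype m]
    (Φ : Matrix n n ℂ →ₗ[ℂ] Matrix m m ℂ) : Prop where
  completelyPositive : ∀ (k : ℕ) (M : Matrix (n × Fin k) (n × Fin k) ℂ),
    M.PosSemidef → (tensorId (Fin k) Φ M).PosSemidef
  tracePreserving : ∀ M : Matrix n n ℂ, (Φ M).trace = M.trace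

/-- The map `ℰ(ξ) = Tr_{B'} [U (ξ ⊗ ρ_B) U†]` from operators on `A` to operators on `A'`. -/
def evolution {A B A' B' : Type*} [Fintype A] [Fintype B] [Fintype B']
    (U : Matrix (A' × B') (A × B) ℂ) (ρB : Matrix B B ℂ) (ξ : Matrix A A ℂ) : Matrix A' A' ℂ :=
  traceSnd (U * (ξ ⊗ₖ ρB) * Uᴴ)

/-- The state `U (ρ_{A R_A} ⊗ ρ_{B R_B}) U†` of the total system, where `U` acts on `AB` and
trivially on `R_A R_B`. The tensor factors are ordered as `(A' B') (R_A R_B)`. -/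
def totalFinalState {A B A' B' RA RB : Type*} [Fintype A] [Fintype B] [Fintype RA] [Fintype RB]
    [DecidableEq RA] [DecidableEq RB] (U : Matrix (A' × B') (A × B) ℂ)
    (ρA : Matrix (A × RA) (A × RA) ℂ) (ρB : Matrix (B × RB) (B × RB) ℂ) :
    Matrix ((A' × B') × (RA × RB)) ((A' × B') × (RA × RB)) ℂ :=
  (U ⊗ₖ (1 : Matrix (RA × RB) (RA × RB) ℂ)) *
    (ρA ⊗ₖ ρB).submatrix (Equiv.prodProdProdComm A B RA RB) (Equiv.prodProdProdComm A B RA RB) *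
    (U ⊗ₖ (1 : Matrix (RA × RB) (RA × RB) ℂ))ᴴ

/-- The state `Tr_{B'} [U (ρ_{A R_A} ⊗ ρ_{B R_B}) U†]` on which the recovery acts. The tensor
factors are ordered as `(A' R_B) R_A`. -/
def scrambledState {A B A' B' RA RB : Type*} [Fintype A] [Fintype B] [Fintype B']
    [Fintype RA] [Fintype RB]
    [DecidableEq RA] [DecidableEq RB] (U : Matrix (A' × B') (A × B) ℂ)
    (ρA : Matrix (A × RA) (A × RA) ℂ) (ρB : Matrix (B × RB) (B × RB) ℂ) :
    Matrix ((A' × RB) × RA) ((A' × RB) × RA) ℂ :=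
  let reorder : ((A' × RB) × RA) × B' → (A' × B') × (RA × RB) :=
    fun x => ((x.1.1.1, x.2), (x.1.2, x.1.1.2))
  traceSnd ((totalFinalState U ρA ρB).submatrix reorder reorder)

/-- The errors `D_F(ρ_{A R_A}, (ℛ ⊗ id_{R_A}) Tr_{B'} [U (ρ_{A R_A} ⊗ ρ_{B R_B}) U†])` of all
recovery operations `ℛ`, which are the CPTP maps from `A' R_B` to `A`. -/
def recoveryErrors {A B A' B' RA RB : Type*} [Fintype A] [Fintype B] [Fintype A'] [Fintype B']
    [Fintype RA] [Fintype RB] [DecidableEq A] [DecidableEq RA] [DecidableEq RB]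
    (U : Matrix (A' × B') (A × B) ℂ)
    (ρA : Matrix (A × RA) (A × RA) ℂ) (ρB : Matrix (B × RB) (B × RB) ℂ) : Set ℝ :=
  {d | ∃ R : Matrix (A' × RB) (A' × RB) ℂ →ₗ[ℂ] Matrix A A ℂ, IsChannel R ∧
    d = purifiedDistance ρA (tensorId RA R (scrambledState U ρA ρB))}

/-- The recovery error `δ`, the minimum of the errors of all recovery operations. -/
def recoveryError {A B A' B' RA RB : Type*} [Fintype A] [Fintype B] [Fintype A'] [Fintype B']
    [Fintype RA] [Fintype RB] [DecidableEq A] [DecidableEq RA] [DecidableEq RB]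
    (U : Matrix (A' × B') (A × B) ℂ)
    (ρA : Matrix (A × RA) (A × RA) ℂ) (ρB : Matrix (B × RB) (B × RB) ℂ) : ℝ :=
  sInf (recoveryErrors U ρA ρB)

/-- `{p_j, ρ_j}` is a decomposition `ρ = ∑ⱼ pⱼ ρⱼ` of `ρ` into density operators. -/
structure IsDecomposition {n : Type*} [Fintype n] (ρ : Matrix n n ℂ) {N : ℕ}
    (p : Fin N → ℝ) (σ : Fin N → Matrix n n ℂ) : Prop where
  nonneg : ∀ j, 0 ≤ p j
  sum_eq_one : ∑ j, p j = 1
  isDensity : ∀ j, IsDensity (σ j)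
  sum_smul : ∑ j, (p j : ℂ) • σ j = ρ

/-- The quantity
`Δ = (⟨X_A⟩_ξ - ⟨X_{A'}⟩_{ℰ(ξ)}) - (⟨X_A⟩_ρ - ⟨X_{A'}⟩_{ℰ(ρ)})`. -/
def localChange {A A' : Type*} [Fintype A] [Fintype A'] (XA : Matrix A A ℂ)
    (XA' : Matrix A' A' ℂ) (E : Matrix A A ℂ → Matrix A' A' ℂ) (ρ ξ : Matrix A A ℂ) : ℝ :=
  (expect XA ξ - expect XA' (E ξ)) - (expect XA ρ - expect XA' (E ρ))

/-- The values `∑ⱼ pⱼ |Δⱼ|` over all decompositions `ρ = ∑ⱼ pⱼ ρⱼ`. -/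
def fluctuations {A A' : Type*} [Fintype A] [Fintype A'] (XA : Matrix A A ℂ)
    (XA' : Matrix A' A' ℂ) (E : Matrix A A ℂ → Matrix A' A' ℂ) (ρ : Matrix A A ℂ) : Set ℝ :=
  {a | ∃ (N : ℕ) (p : Fin N → ℝ) (σ : Fin N → Matrix A A ℂ), IsDecomposition ρ p σ ∧
    a = ∑ j, p j * |localChange XA XA' E ρ (σ j)|}

/-- The dynamical fluctuation `𝒜(ρ, ℰ)`, the maximum of `∑ⱼ pⱼ |Δⱼ|` over all decompositions. -/
def dynamicalFluctuation {A A' : Type*} [Fintype A] [Fintype A'] (XA : Matrix A A ℂ)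
    (XA' : Matrix A' A' ℂ) (E : Matrix A A ℂ → Matrix A' A' ℂ) (ρ : Matrix A A ℂ) : ℝ :=
  sSup (fluctuations XA XA' E ρ)

end QRecovery

end

/-! Information about `A` that leaks into `B'` spoils the recovery, and the conservation law forces
such a leak. The deviations `Δ_j` average to zero, so the mean of their absolute values is twice its
positive part. An optimal decomposition is therefore a splitting of `ρ_A` into `σ` and `ρ_A - σ`
(`exists_isGreatest_decomposition`), and `𝒜 / 2` is the loss functional at the traceless operator `σ
- s ρ_A`, with `s = Tr σ`. Since `ψ` purifies `ρ_A`, this operator is steered by a Hermitian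
contraction `T` on `R_A` with mean zero in `ψ` (`exists_eq_mul_mul_conjTranspose`,
`traceSnd_pureState_mul`). By conservation, what `A` loses appears on `B'`: the loss is the
correlation of `T` with `Y = X_{B'} - y` in the final state (`meanLoss_eq_of_trace_eq_zero`). The
recovery touches neither `R_A` nor `B'`, so it preserves this correlation. Perfect recovery would
give a product of `ψ` with a state of `B'`, hence correlation zero; with error `d`, Cauchy–Schwarz
bounds it by `2 d √⟨Y²⟩` (`abs_re_trace_mul_le`, `abs_re_trace_le_purifiedDistance`). Conservation
and the triangle inequality give `√⟨Y²⟩ ≤ w + Δ₊`, where `w` is the standard deviation of `X_B`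
(`exists_sqrt_trace_le`), and `√𝓕 = 2 w` for a pure state (`tendsto_fisherQuotient_pureState`). Thus
`𝒜 ≤ 4 d (w + Δ₊) = 2 d (√𝓕 + 2 Δ₊)`, which is slightly stronger than needed. The maximum and the
minimum exist by compactness of the operators between `0` and `ρ_A` and of the set of channels. -/

namespace QRecovery

/-! ### Cauchy–Schwarz estimates in the seminorm of a state -/

section WeightedNorm

variable {n : Type*} [Fintype n]

/-- The seminorm `a ↦ √(Tr (a ω a†))` on operators, for a positive semidefinite weight `ω`. -/
noncomputable def weightedNorm (ω a : Matrix n n ℂ) : ℝ := √(a * ω * aᴴ).trace.re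

theorem weightedNorm_nonneg (ω a : Matrix n n ℂ) : 0 ≤ weightedNorm ω a := Real.sqrt_nonneg _

/-- Cauchy–Schwarz for the semi-inner product that the weight defines on operators. -/
theorem norm_trace_mul_mul_conjTranspose_le {ω : Matrix n n ℂ} (hω : ω.PosSemidef)
    (a b : Matrix n n ℂ) : ‖(b * ω * aᴴ).trace‖ ≤ weightedNorm ω a * weightedNorm ω b := by
  let := ω.toMatrixSeminormedAddCommGroup hω
  let := ω.toMatrixInnerProductSpace hω
  exact norm_inner_le_norm (𝕜 := ℂ) a b

theorem weightedNorm_add_le {ω : Matrix n n ℂ} (hω : ω.PosSemidef) (a b : Matrix n n ℂ) :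
    weightedNorm ω (a + b) ≤ weightedNorm ω a + weightedNorm ω b := by
  let := ω.toMatrixSeminormedAddCommGroup hω
  exact norm_add_le a b

theorem weightedNorm_neg (ω a : Matrix n n ℂ) : weightedNorm ω (-a) = weightedNorm ω a := by
  simp [weightedNorm]

theorem trace_mul_re_nonneg {ω c : Matrix n n ℂ} (hω : ω.PosSemidef) (hc : c.PosSemidef) :
    0 ≤ (ω * c).trace.re := by
  classical
  obtain ⟨b, rfl⟩ := CStarAlgebra.nonneg_iff_eq_star_mul_self.mp hc.nonneg
  rw [← mul_assoc, Matrix.trace_mul_cycle, Matrix.star_eq_conjTranspose]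
  exact (Complex.nonneg_iff.mp (hω.mul_mul_conjTranspose_same b).trace_nonneg).1

theorem weightedNorm_eq (ω a : Matrix n n ℂ) : weightedNorm ω a = √(ω * (aᴴ * a)).trace.re := by
  rw [weightedNorm, ← mul_assoc, Matrix.trace_mul_cycle, ← Matrix.trace_mul_cycle, mul_assoc a,
    Matrix.trace_mul_comm a]

theorem weightedNorm_le_of_posSemidef {ω a b : Matrix n n ℂ} (hω : ω.PosSemidef)
    (h : (bᴴ * b - aᴴ * a).PosSemidef) : weightedNorm ω a ≤ weightedNorm ω b := by
  rw [weightedNorm_eq, weightedNorm_eq]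
  apply Real.sqrt_le_sqrt
  have := trace_mul_re_nonneg hω h
  rw [mul_sub, Matrix.trace_sub, Complex.sub_re] at this
  linarith

theorem weightedNorm_mul_le [DecidableEq n] {ω t a : Matrix n n ℂ} (hω : ω.PosSemidef)
    (ht : (1 - tᴴ * t).PosSemidef) : weightedNorm ω (t * a) ≤ weightedNorm ω a := by
  apply weightedNorm_le_of_posSemidef hω
  convert ht.conjTranspose_mul_mul_same a using 1
  simp only [Matrix.conjTranspose_mul, mul_sub, sub_mul, mul_one, mul_assoc]

/-- If the Hermitian contraction `T` commutes with `Y` and has vanishing block on the range of the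
projection `P`, which commutes with `Y`, then the expectation value of `T Y` is controlled by the
weight of the state `ω` outside `P`. -/
theorem abs_re_trace_mul_le [DecidableEq n] {ω T Y P : Matrix n n ℂ} (hω : ω.PosSemidef)
    (hT : T.IsHermitian) (hY : Y.IsHermitian) (hP : P.IsHermitian) (hPP : P * P = P)
    (hPTP : P * T * P = 0) (hPY : P * Y = Y * P) (hTY : T * Y = Y * T)
    (hT1 : (1 - T * T).PosSemidef) :
    |(ω * (T * Y)).trace.re| ≤ 2 * (√(ω * (1 - P)).trace.re * √(ω * (Y * Y)).trace.re) := by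
  have hQ : (1 - P)ᴴ = 1 - P := by
    rw [Matrix.conjTranspose_sub, Matrix.conjTranspose_one, hP.eq]
  have hQQ : (1 - P) * (1 - P) = 1 - P := by
    rw [mul_sub, sub_mul, sub_mul, hPP]; simp
  -- The block `P Y T P = Y P T P` vanishes, so every remaining term carries a factor `1 - P`, which
  -- Cauchy–Schwarz turns into the weight outside `P`.
  have hdec : T * Y = P * (Y * T) * (1 - P) + (1 - P) * (T * Y) := by
    have : P * (Y * T) * P = 0 := by
      rw [← mul_assoc, hPY, mul_assoc Y, mul_assoc Y, hPTP, mul_zero]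
    rw [mul_sub, this, sub_mul, hTY]; simp
  have hT1' : (1 - Tᴴ * T).PosSemidef := by rwa [hT.eq]
  have hP1 : (1 - Pᴴ * P).PosSemidef := by
    rw [hP.eq, hPP, ← hQQ]
    nth_rewrite 1 [← hQ]
    exact Matrix.posSemidef_conjTranspose_mul_self _
  have hnQ : weightedNorm ω (1 - P) = √(ω * (1 - P)).trace.re := by
    rw [weightedNorm_eq, hQ, hQQ]
  have hnY : weightedNorm ω Y = √(ω * (Y * Y)).trace.re := by rw [weightedNorm_eq, hY.eq]
  have h1 : ‖(ω * (P * (Y * T) * (1 - P))).trace‖ ≤ weightedNorm ω Y * weightedNorm ω (1 - P) := by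
    have := norm_trace_mul_mul_conjTranspose_le hω (T * Y * P) (1 - P)
    rw [Matrix.conjTranspose_mul, Matrix.conjTranspose_mul, hP.eq, hY.eq, hT.eq,
      Matrix.trace_mul_cycle, Matrix.trace_mul_comm] at this
    refine this.trans (mul_le_mul_of_nonneg_right ?_ (weightedNorm_nonneg _ _))
    rw [mul_assoc, ← hPY]
    exact (weightedNorm_mul_le hω hT1').trans (weightedNorm_mul_le hω hP1)
  have h2 : ‖(ω * ((1 - P) * (T * Y))).trace‖ ≤ weightedNorm ω (1 - P) * weightedNorm ω Y := by
    have := norm_trace_mul_mul_conjTranspose_le hω (1 - P) (T * Y)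
    rw [hQ, Matrix.trace_mul_cycle, Matrix.trace_mul_comm] at this
    exact this.trans (mul_le_mul_of_nonneg_left (weightedNorm_mul_le hω hT1')
      (weightedNorm_nonneg _ _))
  rw [hdec, mul_add, Matrix.trace_add]
  refine (Complex.abs_re_le_norm _).trans ((norm_add_le _ _).trans ?_)
  rw [← hnQ, ← hnY]
  linarith

end WeightedNorm

/-! ### Eigenvalue spread -/

section Spread

variable {n : Type*} [Fintype n] [DecidableEq n]

/-- A Hermitian matrix differs from the midpoint of its spectrum by at most half the spread. -/
theorem exists_posSemidef_sq_sub_sq {X : Matrix n n ℂ} (hX : X.IsHermitian) :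
    ∃ c : ℝ, ((((eigenvalueSpread hX / 2 : ℝ) : ℂ) ^ 2) • (1 : Matrix n n ℂ) -
      (X - (c : ℂ) • 1) * (X - (c : ℂ) • 1)).PosSemidef := by
  set M := ⨆ i, hX.eigenvalues i with hM
  set m := ⨅ i, hX.eigenvalues i with hm
  refine ⟨(M + m) / 2, ?_⟩
  have hb : BddAbove (Set.range hX.eigenvalues) := (Set.finite_range _).bddAbove
  have hb' : BddBelow (Set.range hX.eigenvalues) := (Set.finite_range _).bddBelow
  set V : Matrix n n ℂ := (hX.eigenvectorUnitary : Matrix n n ℂ) with hV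
  have hVV : V * star V = 1 := Unitary.coe_mul_star_self _
  have hVV' : star V * V = 1 := Unitary.coe_star_mul_self _
  have hspec : X = V * Matrix.diagonal (fun i => (hX.eigenvalues i : ℂ)) * star V := by
    have := hX.spectral_theorem
    rw [Unitary.conjStarAlgAut_apply] at this
    exact this
  have hsub : X - (((M + m) / 2 : ℝ) : ℂ) • 1 =
      V * Matrix.diagonal (fun i => ((hX.eigenvalues i - (M + m) / 2 : ℝ) : ℂ)) * star V := by
    have : (fun i => ((hX.eigenvalues i - (M + m) / 2 : ℝ) : ℂ)) =
        fun i => (hX.eigenvalues i : ℂ) - (((M + m) / 2 : ℝ) : ℂ) := by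
      ext i; simp
    rw [this, ← Matrix.diagonal_sub, mul_sub, sub_mul, ← hspec, ← Matrix.smul_one_eq_diagonal]
    simp [hVV]
  -- On an eigenvalue `λ` this is `((M - m)/2)² - (λ - (M + m)/2)² = (M - λ)(λ - m)`, which is
  -- nonnegative.
  have hfin : ((eigenvalueSpread hX / 2 : ℝ) : ℂ) ^ 2 • (1 : Matrix n n ℂ) -
      (X - (((M + m) / 2 : ℝ) : ℂ) • 1) * (X - (((M + m) / 2 : ℝ) : ℂ) • 1) =
      V * Matrix.diagonal (fun i =>
        (((M - hX.eigenvalues i) * (hX.eigenvalues i - m) : ℝ) : ℂ)) * Vᴴ := by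
    have e : (fun i => (((M - hX.eigenvalues i) * (hX.eigenvalues i - m) : ℝ) : ℂ)) =
        fun i => ((eigenvalueSpread hX / 2 : ℝ) : ℂ) ^ 2 -
          ((hX.eigenvalues i - (M + m) / 2 : ℝ) : ℂ) *
          ((hX.eigenvalues i - (M + m) / 2 : ℝ) : ℂ) := by
      ext i
      simp only [eigenvalueSpread, ← hM, ← hm]
      push_cast
      ring
    rw [e, ← Matrix.diagonal_sub, ← Matrix.diagonal_mul_diagonal, hsub, mul_sub, sub_mul,
      ← Matrix.smul_one_eq_diagonal, ← Matrix.star_eq_conjTranspose]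
    congr 1
    · simp [hVV]
    · simp only [mul_assoc]
      rw [← mul_assoc (star V) V, hVV', one_mul]
  rw [hfin]
  refine (Matrix.PosSemidef.diagonal fun i => ?_).mul_mul_conjTranspose_same V
  simp only [Pi.zero_apply]
  exact_mod_cast mul_nonneg (sub_nonneg.2 (le_ciSup hb i)) (sub_nonneg.2 (ciInf_le hb' i))

theorem eigenvalueSpread_nonneg {X : Matrix n n ℂ} (hX : X.IsHermitian) :
    0 ≤ eigenvalueSpread hX := by
  rcases isEmpty_or_nonempty n with h | h
  · simp [eigenvalueSpread]
  · exact sub_nonneg.2 (ciInf_le_ciSup (Set.finite_range _).bddBelow (Set.finite_range _).bddAbove)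

end Spread

/-! ### Fidelity with a pure state -/

section PureStates

variable {n : Type*} [Fintype n]

theorem pureState_eq_vecMulVec {n : Type*} (v : EuclideanSpace ℂ n) :
    pureState v = Matrix.vecMulVec v.ofLp (star v.ofLp) := rfl

theorem posSemidef_pureState (v : EuclideanSpace ℂ n) : (pureState v).PosSemidef :=
  Matrix.posSemidef_vecMulVec_self_star _

theorem trace_pureState (v : EuclideanSpace ℂ n) : (pureState v).trace = ((‖v‖ ^ 2 : ℝ) : ℂ) := by
  rw [EuclideanSpace.norm_sq_eq]
  simp [Matrix.trace, pureState, Complex.mul_conj, Complex.normSq_eq_norm_sq]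

theorem mul_pureState_mul_conjTranspose (a : Matrix n n ℂ) (v : EuclideanSpace ℂ n) :
    a * pureState v * aᴴ = pureState (WithLp.toLp 2 (a *ᵥ v.ofLp)) := by
  rw [pureState_eq_vecMulVec, pureState_eq_vecMulVec, Matrix.mul_vecMulVec, Matrix.vecMulVec_mul,
    Matrix.star_mulVec]

theorem pureState_mul_mul_pureState (v : EuclideanSpace ℂ n) (a : Matrix n n ℂ) :
    pureState v * a * pureState v = (pureState v * a).trace • pureState v := by
  rw [pureState_eq_vecMulVec, Matrix.vecMulVec_mul, Matrix.vecMulVec_mul_vecMulVec,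
    Matrix.trace_vecMulVec, Matrix.vecMulVec_smul, dotProduct_comm]

/-- The root of `|v⟩⟨v|` is `|v⟩⟨v| / ‖v‖`. The vector is not normalized because the lemma is
applied to `√σ v`. -/
theorem sq_trace_sqrt_pureState [DecidableEq n] (v : EuclideanSpace ℂ n) :
    (CFC.sqrt (pureState v)).trace.re ^ 2 = ‖v‖ ^ 2 := by
  rcases eq_or_ne v 0 with rfl | hv
  · have : pureState (0 : EuclideanSpace ℂ n) = 0 := by ext; simp [pureState]
    simp [this]
  have hv' : (‖v‖ : ℂ) ≠ 0 := by exact_mod_cast norm_ne_zero_iff.2 hv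
  have hps := posSemidef_pureState v
  have hsq : pureState v * pureState v = ((‖v‖ ^ 2 : ℝ) : ℂ) • pureState v := by
    simpa [trace_pureState] using pureState_mul_mul_pureState v 1
  have : CFC.sqrt (pureState v) = ((‖v‖⁻¹ : ℝ) : ℂ) • pureState v := by
    apply CFC.sqrt_unique
    · rw [smul_mul_smul_comm, hsq, smul_smul]
      convert one_smul ℂ _
      push_cast
      field_simp
    · exact (hps.smul (a := ((‖v‖⁻¹ : ℝ) : ℂ)) (by
        exact_mod_cast inv_nonneg.2 (norm_nonneg v))).nonneg
  rw [this, Matrix.trace_smul, trace_pureState, smul_eq_mul, ← Complex.ofReal_mul,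
    Complex.ofReal_re]
  have := norm_ne_zero_iff.2 hv
  field_simp

theorem fidelity_pureState_sq [DecidableEq n] (v : EuclideanSpace ℂ n) {σ : Matrix n n ℂ}
    (hσ : σ.PosSemidef) : fidelity (pureState v) σ ^ 2 = (σ * pureState v).trace.re := by
  have hs : (CFC.sqrt σ)ᴴ = CFC.sqrt σ := (Matrix.nonneg_iff_posSemidef.1 (CFC.sqrt_nonneg σ)).isHermitian
  have hmul : CFC.sqrt σ * pureState v * CFC.sqrt σ =
      pureState (WithLp.toLp 2 (CFC.sqrt σ *ᵥ v.ofLp)) := by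
    rw [← mul_pureState_mul_conjTranspose, hs]
  rw [fidelity, hmul, sq_trace_sqrt_pureState, ← Complex.ofReal_re (‖_‖ ^ 2), ← trace_pureState,
    ← hmul, Matrix.trace_mul_cycle, CFC.sqrt_mul_sqrt_self σ hσ.nonneg]

theorem purifiedDistance_pureState [DecidableEq n] (v : EuclideanSpace ℂ n) {σ : Matrix n n ℂ}
    (hσ : σ.PosSemidef) :
    purifiedDistance (pureState v) σ = √(1 - (σ * pureState v).trace.re) := by
  rw [purifiedDistance, fidelity_pureState_sq v hσ]

end PureStates

/-! ### Fisher information of a pure state as a variance -/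

section FisherInformation

variable {n : Type*} [Fintype n] [DecidableEq n]

theorem tendsto_one_sub_cos_mul_div_sq (x : ℝ) :
    Tendsto (fun ε : ℝ => (1 - Real.cos (ε * x)) / ε ^ 2) (𝓝[≠] 0) (𝓝 (x ^ 2 / 2)) := by
  have h : HasDerivAt (fun ε : ℝ => Real.sin (ε * (x / 2))) (x / 2) 0 := by
    simpa using ((hasDerivAt_id (0 : ℝ)).mul_const (x / 2)).sin
  have h2 := ((hasDerivAt_iff_tendsto_slope.1 h).pow 2).const_mul 2
  have e : 2 * (x / 2) ^ 2 = x ^ 2 / 2 := by ring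
  rw [e] at h2
  refine h2.congr fun ε => ?_
  have : ε * x = 2 * (ε * (x / 2)) := by ring
  rw [slope_def_field, this, Real.cos_two_mul, Real.cos_sq']
  simp
  ring

theorem trace_mul_diagonal_mul_mul_diagonal {n : Type*} [Fintype n] [DecidableEq n]
    (ρ : Matrix n n ℂ) (d e : n → ℂ) :
    (ρ * Matrix.diagonal d * (ρ * Matrix.diagonal e)).trace =
      ∑ k, ∑ l, ρ k l * ρ l k * (d l * e k) := by
  simp only [Matrix.trace, Matrix.diag, Matrix.mul_apply (M := ρ * _), Matrix.mul_diagonal]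
  exact Finset.sum_congr rfl fun k _ => Finset.sum_congr rfl fun l _ => by ring

theorem exp_smul_eq {X : Matrix n n ℂ} (hX : X.IsHermitian) (z : ℂ) :
    NormedSpace.exp (z • X) = (hX.eigenvectorUnitary : Matrix n n ℂ) *
      Matrix.diagonal (fun i => Complex.exp (z * hX.eigenvalues i)) *
      star (hX.eigenvectorUnitary : Matrix n n ℂ) := by
  set V : Matrix n n ℂ := (hX.eigenvectorUnitary : Matrix n n ℂ)
  have hVV : V * star V = 1 := Unitary.coe_mul_star_self _
  have hspec : X = V * Matrix.diagonal (fun i => (hX.eigenvalues i : ℂ)) * star V := by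
    have := hX.spectral_theorem
    rw [Unitary.conjStarAlgAut_apply] at this
    exact this
  have hinv : V⁻¹ = star V := Matrix.inv_eq_right_inv hVV
  have hu : IsUnit V := IsUnit.of_mul_eq_one _ hVV
  have hz : z • X = V * Matrix.diagonal (fun i => z * (hX.eigenvalues i : ℂ)) * V⁻¹ := by
    conv_lhs => rw [hspec]
    rw [hinv, ← smul_mul_assoc, ← mul_smul_comm, ← Matrix.diagonal_smul]
    rfl
  rw [hz, Matrix.exp_conj _ _ hu, Matrix.exp_diagonal, hinv]
  congr 3
  ext i
  rw [Pi.exp_def, Complex.exp_eq_exp_ℂ]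

/-- Second order expansion of the overlap of a state with its translate. -/
theorem exists_overlap_expansion {X ρ : Matrix n n ℂ} (hX : X.IsHermitian) (hρ : ρ.IsHermitian) :
    ∃ (c : n → n → ℝ) (x : n → n → ℝ), (∀ k l, 0 ≤ c k l) ∧
      (∀ ε : ℝ, (ρ * ρ).trace.re - (ρ * (NormedSpace.exp (-(Complex.I * (ε : ℂ)) • X) * ρ *
        NormedSpace.exp ((Complex.I * (ε : ℂ)) • X))).trace.re =
          ∑ k, ∑ l, c k l * (1 - Real.cos (ε * x k l))) ∧
      (ρ * ρ * (X * X)).trace.re - (ρ * X * (ρ * X)).trace.re =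
        ∑ k, ∑ l, c k l * (x k l ^ 2 / 2) := by
  set V : Matrix n n ℂ := (hX.eigenvectorUnitary : Matrix n n ℂ) with hV
  have hVV : V * star V = 1 := Unitary.coe_mul_star_self _
  have hVV' : star V * V = 1 := Unitary.coe_star_mul_self _
  have hspec : X = V * Matrix.diagonal (fun i => (hX.eigenvalues i : ℂ)) * star V := by
    have := hX.spectral_theorem
    rw [Unitary.conjStarAlgAut_apply] at this
    exact this
  set τ := star V * ρ * V with hτ
  have hτh : τ.IsHermitian := by
    rw [hτ, Matrix.star_eq_conjTranspose]
    exact Matrix.isHermitian_conjTranspose_mul_mul V hρ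
  have hρτ : ρ = V * τ * star V := by
    rw [hτ, ← mul_assoc, ← mul_assoc, hVV, one_mul, mul_assoc, hVV, mul_one]
  have hτs : ∀ k l, τ k l * τ l k = ((Complex.normSq (τ k l) : ℝ) : ℂ) := fun k l => by
    rw [← hτh.apply l k, Complex.normSq_eq_conj_mul_self, mul_comm]; rfl
  have key : ∀ d e : n → ℂ, (ρ * (V * Matrix.diagonal d * star V) *
      (ρ * (V * Matrix.diagonal e * star V))).trace =
        ∑ k, ∑ l, ((Complex.normSq (τ k l) : ℝ) : ℂ) * (d l * e k) := fun d e => by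
    have : ρ * (V * Matrix.diagonal d * star V) * (ρ * (V * Matrix.diagonal e * star V)) =
        V * (τ * Matrix.diagonal d * (τ * Matrix.diagonal e)) * star V := by
      rw [hρτ]
      simp only [mul_assoc]
      simp only [← mul_assoc (star V) V, hVV', one_mul]
    rw [this, Matrix.trace_mul_comm, ← mul_assoc, hVV', one_mul,
      trace_mul_diagonal_mul_mul_diagonal]
    simp only [hτs]
  have hone : (1 : Matrix n n ℂ) = V * Matrix.diagonal (fun _ => 1) * star V := by
    rw [Matrix.diagonal_one, mul_one, hVV]
  refine ⟨fun k l => Complex.normSq (τ k l), fun k l => hX.eigenvalues k - hX.eigenvalues l,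
    fun _ _ => Complex.normSq_nonneg _, fun ε => ?_, ?_⟩
  · have h1 : (ρ * ρ).trace = (ρ * 1 * (ρ * 1)).trace := by simp
    have h2 : ρ * (NormedSpace.exp (-(Complex.I * (ε : ℂ)) • X) * ρ *
        NormedSpace.exp ((Complex.I * (ε : ℂ)) • X)) =
        ρ * NormedSpace.exp (-(Complex.I * (ε : ℂ)) • X) * (ρ *
        NormedSpace.exp ((Complex.I * (ε : ℂ)) • X)) := by simp only [mul_assoc]
    rw [h1, h2, exp_smul_eq hX, exp_smul_eq hX, hone, key, key, ← Complex.sub_re,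
      ← Finset.sum_sub_distrib, Complex.re_sum]
    refine Finset.sum_congr rfl fun k _ => ?_
    rw [← Finset.sum_sub_distrib, Complex.re_sum]
    refine Finset.sum_congr rfl fun l _ => ?_
    rw [← mul_sub, Complex.re_ofReal_mul, ← Complex.exp_add]
    congr 1
    have : -(Complex.I * (ε : ℂ)) * (hX.eigenvalues l : ℂ) +
        Complex.I * (ε : ℂ) * (hX.eigenvalues k : ℂ) =
        ((ε * (hX.eigenvalues k - hX.eigenvalues l) : ℝ) : ℂ) * Complex.I := by
      push_cast; ring
    rw [this, Complex.sub_re, Complex.exp_ofReal_mul_I_re]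
    simp
  · have hXX : X * X = V * Matrix.diagonal (fun i => (hX.eigenvalues i : ℂ) ^ 2) * star V := by
      conv_lhs => rw [hspec]
      have : (fun i => (hX.eigenvalues i : ℂ) ^ 2) =
          fun i => (hX.eigenvalues i : ℂ) * hX.eigenvalues i := by ext; ring
      rw [this, ← Matrix.diagonal_mul_diagonal]
      simp only [mul_assoc]
      rw [← mul_assoc (star V) V, hVV', one_mul]
    have h1 : (ρ * ρ * (X * X)).trace = (ρ * 1 * (ρ * (X * X))).trace := by simp [mul_assoc]
    have h2 : (ρ * ρ * (X * X)).trace = (ρ * (X * X) * (ρ * 1)).trace := by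
      rw [mul_one, Matrix.trace_mul_comm, ← mul_assoc, Matrix.trace_mul_comm, ← mul_assoc]
    have keyR : ∀ d e : n → ℝ, (ρ * (V * Matrix.diagonal (fun i => (d i : ℂ)) * star V) *
        (ρ * (V * Matrix.diagonal (fun i => (e i : ℂ)) * star V))).trace.re =
          ∑ k, ∑ l, Complex.normSq (τ k l) * (d l * e k) := fun d e => by
      rw [key]
      simp only [← Complex.ofReal_mul, ← Complex.ofReal_sum, Complex.ofReal_re]
    have e1 := keyR (fun _ => 1) (fun i => hX.eigenvalues i ^ 2)
    have e2 := keyR (fun i => hX.eigenvalues i ^ 2) (fun _ => 1)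
    have e3 := keyR hX.eigenvalues hX.eigenvalues
    simp only [Complex.ofReal_one, Complex.ofReal_pow, ← hone, ← hXX] at e1 e2
    rw [← hspec] at e3
    rw [← h1] at e1
    rw [← h2] at e2
    -- Expanding the square, `λ_k²` and `λ_l²` each contribute `Tr (ρ² X²)`, and the cross term
    -- gives `Tr (ρXρX)`.
    have : ∑ k, ∑ l, Complex.normSq (τ k l) *
        ((hX.eigenvalues k - hX.eigenvalues l) ^ 2 / 2) =
        ((ρ * ρ * (X * X)).trace.re + (ρ * ρ * (X * X)).trace.re) / 2 -
          (ρ * X * (ρ * X)).trace.re := by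
      nth_rewrite 1 [e1]
      rw [e2, e3, ← Finset.sum_add_distrib, Finset.sum_div, ← Finset.sum_sub_distrib]
      refine Finset.sum_congr rfl fun k _ => ?_
      rw [← Finset.sum_add_distrib, Finset.sum_div, ← Finset.sum_sub_distrib]
      exact Finset.sum_congr rfl fun l _ => by ring
    rw [this]
    ring

theorem sq_weightedNorm_sub_mean {ρ X : Matrix n n ℂ} (hρ : ρ.PosSemidef) (htr : ρ.trace = 1)
    (hX : X.IsHermitian) :
    weightedNorm ρ (X - ((expect X ρ : ℝ) : ℂ) • 1) ^ 2 =
      (ρ * (X * X)).trace.re - expect X ρ ^ 2 := by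
  have hH : (X - ((expect X ρ : ℝ) : ℂ) • 1)ᴴ = X - ((expect X ρ : ℝ) : ℂ) • 1 := by
    simp [hX.eq]
  have h0 := (trace_mul_re_nonneg hρ (Matrix.posSemidef_conjTranspose_mul_self
    (X - ((expect X ρ : ℝ) : ℂ) • 1)))
  rw [weightedNorm_eq, Real.sq_sqrt h0, hH]
  have : ρ * ((X - ((expect X ρ : ℝ) : ℂ) • 1) * (X - ((expect X ρ : ℝ) : ℂ) • 1)) =
      ρ * (X * X) - (2 * ((expect X ρ : ℝ) : ℂ)) • (ρ * X) +
        (((expect X ρ : ℝ) : ℂ) * ((expect X ρ : ℝ) : ℂ)) • ρ := by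
    simp only [mul_sub, sub_mul, mul_smul_comm, smul_mul_assoc, mul_one, one_mul]
    module
  rw [this, Matrix.trace_add, Matrix.trace_sub, Matrix.trace_smul, Matrix.trace_smul, htr,
    Matrix.trace_mul_comm ρ X]
  simp only [smul_eq_mul, mul_one, Complex.add_re, Complex.sub_re, ← Complex.ofReal_mul,
    Complex.ofReal_re]
  have e : (2 * ((expect X ρ : ℝ) : ℂ) * (X * ρ).trace).re = 2 * expect X ρ * expect X ρ := by
    rw [show (2 * ((expect X ρ : ℝ) : ℂ)) = ((2 * expect X ρ : ℝ) : ℂ) by push_cast; ring,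
      Complex.re_ofReal_mul]
    rfl
  rw [e]
  ring

/-- The quantum Fisher information of a pure state is four times the variance. -/
theorem tendsto_fisherQuotient_pureState {φ : EuclideanSpace ℂ n} (hφ : ‖φ‖ = 1)
    {X : Matrix n n ℂ} (hX : X.IsHermitian) :
    Tendsto (fisherQuotient (pureState φ) X) (𝓝[≠] 0) (𝓝 (4 *
      weightedNorm (pureState φ) (X - ((expect X (pureState φ) : ℝ) : ℂ) • 1) ^ 2)) := by
  set ρ := pureState φ with hρ
  have hps : ρ.PosSemidef := posSemidef_pureState φ
  have htr : ρ.trace = 1 := by rw [hρ, trace_pureState, hφ]; simp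
  have hρρ : ρ * ρ = ρ := by
    have := pureState_mul_mul_pureState φ 1
    rwa [mul_one, ← hρ, htr, one_smul] at this
  obtain ⟨c, x, hc, h1, h2⟩ := exists_overlap_expansion hX hps.isHermitian
  -- For pure `ρ`, `ρXρ = Tr (ρX) ρ`, so `Tr (ρXρX)` is the squared mean and the second-order
  -- coefficient is the variance.
  have hvar : weightedNorm ρ (X - ((expect X ρ : ℝ) : ℂ) • 1) ^ 2 =
      ∑ k, ∑ l, c k l * (x k l ^ 2 / 2) := by
    rw [sq_weightedNorm_sub_mean hps htr hX, ← h2, hρρ, ← mul_assoc (ρ * X),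
      pureState_mul_mul_pureState, smul_mul_assoc, Matrix.trace_smul, smul_eq_mul,
      expect, Matrix.trace_mul_comm X ρ]
    have him : (ρ * X).trace.im = 0 := by
      have := Matrix.trace_conjTranspose (ρ * X)
      rw [Matrix.conjTranspose_mul, hX.eq, hps.isHermitian.eq, Matrix.trace_mul_comm] at this
      exact Complex.conj_eq_iff_im.1 this.symm
    rw [Complex.mul_re, him]
    ring
  rw [hvar]
  -- The formula is exact for every `ε`, since the fidelity with a pure state is an overlap; the
  -- limit can then be taken term by term.
  have hq : ∀ ε : ℝ, fisherQuotient ρ X ε =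
      4 * ∑ k, ∑ l, c k l * ((1 - Real.cos (ε * x k l)) / ε ^ 2) := fun ε => by
    have hH : (NormedSpace.exp (-(Complex.I * (ε : ℂ)) • X))ᴴ =
        NormedSpace.exp ((Complex.I * (ε : ℂ)) • X) := by
      rw [← Matrix.exp_conjTranspose]
      congr 1
      simp [hX.eq]
    have hnn : 0 ≤ ∑ k, ∑ l, c k l * (1 - Real.cos (ε * x k l)) :=
      Finset.sum_nonneg fun k _ => Finset.sum_nonneg fun l _ =>
        mul_nonneg (hc k l) (sub_nonneg.2 (Real.cos_le_one _))
    have h1' := h1 ε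
    rw [hρρ, htr, Complex.one_re] at h1'
    rw [fisherQuotient]
    nth_rewrite 1 [hρ]
    rw [← hH, mul_pureState_mul_conjTranspose, purifiedDistance_pureState _ hps,
      ← mul_pureState_mul_conjTranspose, hH, ← hρ, h1', Real.sq_sqrt hnn, mul_div_assoc,
      Finset.sum_div]
    simp only [Finset.sum_div, mul_div_assoc]
  refine Tendsto.congr (fun ε => (hq ε).symm) (Tendsto.const_mul 4 ?_)
  exact tendsto_finsetSum _ fun k _ => tendsto_finsetSum _ fun l _ =>
    (tendsto_one_sub_cos_mul_div_sq (x k l)).const_mul (c k l)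

end FisherInformation

/-! ### Compactness for positive operators; partial traces -/

section PosSemidefSets

variable {n : Type*} [Fintype n]

theorem isClosed_setOf_posSemidef : IsClosed {M : Matrix n n ℂ | M.PosSemidef} := by
  simp only [Matrix.posSemidef_iff_dotProduct_mulVec, Set.ofPred_and, Set.ofPred_forall]
  refine IsClosed.inter (isClosed_eq (by fun_prop) continuous_id) (isClosed_iInter fun x => ?_)
  simp only [Complex.nonneg_iff]
  have hc : Continuous fun M : Matrix n n ℂ => star x ⬝ᵥ M *ᵥ x := by fun_prop
  exact (isClosed_le continuous_const (Complex.continuous_re.comp hc)).inter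
    (isClosed_eq continuous_const (Complex.continuous_im.comp hc))

theorem diag_re_le_trace_re {M : Matrix n n ℂ} (hM : M.PosSemidef) (i : n) :
    (M i i).re ≤ M.trace.re := by
  rw [Matrix.trace, Complex.re_sum]
  exact Finset.single_le_sum (f := fun i => (M.diag i).re)
    (fun j _ => (Complex.nonneg_iff.1 hM.diag_nonneg).1) (Finset.mem_univ i)

/-- Nonnegative principal minors of order two give `|M_ij|² ≤ M_ii M_jj`, and a diagonal entry is at
most the trace. -/
theorem norm_apply_le_trace_re {M : Matrix n n ℂ} (hM : M.PosSemidef) (i j : n) :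
    ‖M i j‖ ≤ M.trace.re := by
  have hdet := (hM.submatrix ![i, j]).det_nonneg
  rw [Matrix.det_fin_two] at hdet
  simp only [Matrix.submatrix_apply, Matrix.cons_val_zero, Matrix.cons_val_one] at hdet
  have hre := (Complex.nonneg_iff.1 hdet).1
  have hi := Complex.nonneg_iff.1 (hM.diag_nonneg (i := i))
  have hj := Complex.nonneg_iff.1 (hM.diag_nonneg (i := j))
  have hij : M i j * M j i = ((‖M i j‖ ^ 2 : ℝ) : ℂ) := by
    rw [← hM.isHermitian.apply j i, ← Complex.normSq_eq_norm_sq, ← Complex.mul_conj]; rfl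
  rw [hij, Complex.sub_re, Complex.ofReal_re, Complex.mul_re, ← hi.2] at hre
  have hi' := diag_re_le_trace_re hM i
  have hj' := diag_re_le_trace_re hM j
  refine abs_le_of_sq_le_sq' ?_ (hi.1.trans hi') |>.2
  nlinarith [mul_le_mul hi' hj' hj.1 (hi.1.trans hi')]

theorem isCompact_setOf_posSemidef_le {ρ : Matrix n n ℂ} :
    IsCompact {σ : Matrix n n ℂ | σ.PosSemidef ∧ (ρ - σ).PosSemidef} := by
  have hK : IsCompact (X := Matrix n n ℂ)
      {σ | ∀ i j, σ i j ∈ Metric.closedBall (0 : ℂ) ρ.trace.re} := by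
    have := isCompact_univ_pi (X := fun _ : n => n → ℂ)
      (s := fun _ => Set.univ.pi fun _ => Metric.closedBall (0 : ℂ) ρ.trace.re)
      fun _ => isCompact_univ_pi fun _ => isCompact_closedBall _ _
    simp only [Set.pi, Set.mem_univ, forall_const] at this
    exact this
  refine hK.of_isClosed_subset ?_ fun σ hσ i j => ?_
  · exact isClosed_setOf_posSemidef.inter
      (isClosed_setOf_posSemidef.preimage (continuous_const.sub continuous_id))
  · rw [mem_closedBall_zero_iff]
    have h1 := norm_apply_le_trace_re hσ.1 i j
    have h2 := (Complex.nonneg_iff.1 hσ.2.trace_nonneg).1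
    rw [Matrix.trace_sub, Complex.sub_re] at h2
    linarith

theorem traceSnd_posSemidef {m n : Type*} [Fintype m] [Fintype n] {M : Matrix (m × n) (m × n) ℂ}
    (hM : M.PosSemidef) : (traceSnd M).PosSemidef := by
  have : traceSnd M = ∑ k, M.submatrix (fun i => (i, k)) fun i => (i, k) := by
    ext; simp [traceSnd, Matrix.sum_apply]
  rw [this]
  exact Matrix.posSemidef_sum _ fun k _ => hM.submatrix _

theorem trace_traceSnd {m n : Type*} [Fintype m] [Fintype n] (M : Matrix (m × n) (m × n) ℂ) :
    (traceSnd M).trace = M.trace := by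
  simp [Matrix.trace, traceSnd, Fintype.sum_prod_type]

theorem trace_traceSnd_mul {m n : Type*} [Fintype m] [Fintype n] [DecidableEq n]
    (M : Matrix (m × n) (m × n) ℂ) (P : Matrix m m ℂ) :
    (traceSnd M * P).trace = (M * (P ⊗ₖ (1 : Matrix n n ℂ))).trace := by
  simp only [Matrix.trace, traceSnd, Matrix.diag, Matrix.mul_apply, Matrix.kronecker_apply,
    Matrix.one_apply, Fintype.sum_prod_type, Matrix.of_apply, mul_ite, mul_one, mul_zero,
    Finset.sum_ite_eq', Finset.mem_univ, if_true, Finset.sum_mul]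
  exact Finset.sum_congr rfl fun i _ => Finset.sum_comm

end PosSemidefSets

/-! ### Channels and their compactness -/

section Channels

variable {n m : Type*} [Fintype n] [Fintype m]

theorem IsChannel.tensorId_posSemidef {Φ : Matrix n n ℂ →ₗ[ℂ] Matrix m m ℂ} (hΦ : IsChannel Φ)
    {r : Type*} [Fintype r] {M : Matrix (n × r) (n × r) ℂ} (hM : M.PosSemidef) :
    (tensorId r Φ M).PosSemidef := by
  have e := Fintype.equivFin r
  have := (hΦ.completelyPositive _ (M.submatrix (Prod.map id e.symm) (Prod.map id e.symm))
    (hM.submatrix _)).submatrix (Prod.map id e)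
  convert this using 1
  ext x y
  simp [tensorId]

theorem trace_mul_one_kronecker [DecidableEq n] {r : Type*} [Fintype r]
    (M : Matrix (n × r) (n × r) ℂ) (Z : Matrix r r ℂ) :
    (M * ((1 : Matrix n n ℂ) ⊗ₖ Z)).trace = ∑ x, ∑ y, (∑ a, M (a, x) (a, y)) * Z y x := by
  simp only [Matrix.trace, Matrix.diag, Matrix.mul_apply, Matrix.kronecker_apply,
    Matrix.one_apply, Fintype.sum_prod_type, ite_mul, zero_mul, one_mul, mul_ite, mul_zero,
    Finset.sum_mul, Finset.sum_ite_irrel, Finset.sum_const_zero, Finset.sum_ite_eq',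
    Finset.mem_univ, if_true]
  rw [Finset.sum_comm]
  exact Finset.sum_congr rfl fun x _ => Finset.sum_comm

theorem IsChannel.trace_tensorId_mul {Φ : Matrix n n ℂ →ₗ[ℂ] Matrix m m ℂ} (hΦ : IsChannel Φ)
    [DecidableEq n] [DecidableEq m] {r : Type*} [Fintype r] (M : Matrix (n × r) (n × r) ℂ)
    (Z : Matrix r r ℂ) :
    (tensorId r Φ M * ((1 : Matrix m m ℂ) ⊗ₖ Z)).trace =
      (M * ((1 : Matrix n n ℂ) ⊗ₖ Z)).trace := by
  rw [trace_mul_one_kronecker, trace_mul_one_kronecker]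
  refine Finset.sum_congr rfl fun x _ => Finset.sum_congr rfl fun y _ => ?_
  congr 1
  exact hΦ.tracePreserving (Matrix.of fun a b => M (a, x) (b, y))

/-- Discarding a spectator system commutes with the channel. Hence `B'` can be kept until after the
recovery, and its correlations with `R_A` studied in one joint state. -/
theorem tensorId_traceSnd {n m r s : Type*} (Φ : Matrix n n ℂ →ₗ[ℂ] Matrix m m ℂ) [Fintype s]
    (M : Matrix ((n × r) × s) ((n × r) × s) ℂ) :
    tensorId r Φ (traceSnd M) =
      traceSnd ((tensorId (r × s) Φ (M.submatrix (Equiv.prodAssoc n r s).symm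
        (Equiv.prodAssoc n r s).symm)).submatrix
          (Equiv.prodAssoc m r s) (Equiv.prodAssoc m r s)) := by
  refine Matrix.ext fun x y => ?_
  simp only [tensorId, traceSnd, Matrix.of_apply, Matrix.submatrix_apply, Equiv.prodAssoc_apply,
    Equiv.prodAssoc_symm_apply]
  rw [← Matrix.sum_apply, ← map_sum]
  refine congrArg (fun N => Φ N x.1 y.1) ?_
  ext a b
  simp [Matrix.sum_apply]

/-- The linear map on operators with prescribed values on the matrix units. -/
def ofMatrixUnits {m : Type*} (c : n → n → Matrix m m ℂ) : Matrix n n ℂ →ₗ[ℂ] Matrix m m ℂ where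
  toFun M := ∑ i, ∑ j, M i j • c i j
  map_add' M N := by simp [add_smul, Finset.sum_add_distrib]
  map_smul' z M := by simp [mul_smul, Finset.smul_sum]

theorem ofMatrixUnits_single {m : Type*} [DecidableEq n] (Φ : Matrix n n ℂ →ₗ[ℂ] Matrix m m ℂ) :
    ofMatrixUnits (fun i j => Φ (Matrix.single i j 1)) = Φ := by
  ext M : 1
  conv_rhs => rw [Matrix.matrix_eq_sum_single M]
  simp only [ofMatrixUnits, LinearMap.coe_mk, AddHom.coe_mk, map_sum]
  refine Finset.sum_congr rfl fun i _ => Finset.sum_congr rfl fun j _ => ?_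
  rw [← map_smul, Matrix.smul_single, smul_eq_mul, mul_one]

theorem continuous_tensorId_ofMatrixUnits {m r : Type*} (M : Matrix (n × r) (n × r) ℂ) :
    Continuous fun c : n → n → Matrix m m ℂ => tensorId r (ofMatrixUnits c) M := by
  refine continuous_matrix fun x y => ?_
  simp only [tensorId, ofMatrixUnits, LinearMap.coe_mk, AddHom.coe_mk, Matrix.of_apply,
    Matrix.sum_apply, Matrix.smul_apply]
  fun_prop

theorem isCompact_setOf_isChannel :
    IsCompact {c : n → n → Matrix m m ℂ | IsChannel (ofMatrixUnits c)} := by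
  classical
  have hK : IsCompact (X := n → n → Matrix m m ℂ)
      {c | ∀ i j x y, c i j x y ∈ Metric.closedBall (0 : ℂ) (Fintype.card n)} := by
    have := isCompact_univ_pi (X := fun _ : n => n → m → m → ℂ)
      (s := fun _ => Set.univ.pi fun _ => Set.univ.pi fun _ => Set.univ.pi fun _ =>
        Metric.closedBall (0 : ℂ) (Fintype.card n))
      fun _ => isCompact_univ_pi fun _ => isCompact_univ_pi fun _ => isCompact_univ_pi fun _ =>
        isCompact_closedBall _ _
    simp only [Set.pi, Set.mem_univ, forall_const] at this
    exact this
  refine hK.of_isClosed_subset ?_ fun c hc i j x y => ?_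
  · have : {c : n → n → Matrix m m ℂ | IsChannel (ofMatrixUnits c)} =
        (⋂ (k : ℕ) (M : Matrix (n × Fin k) (n × Fin k) ℂ) (_ : M.PosSemidef),
          {c | (tensorId (Fin k) (ofMatrixUnits c) M).PosSemidef}) ∩
        ⋂ M : Matrix n n ℂ, {c | (ofMatrixUnits c M).trace = M.trace} := by
      ext c
      simp only [Set.mem_inter_iff, Set.mem_iInter]
      exact ⟨fun h => ⟨h.1, h.2⟩, fun h => ⟨h.1, h.2⟩⟩
    rw [this]
    refine IsClosed.inter (isClosed_iInter fun k => isClosed_iInter fun M => isClosed_iInter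
      fun _ => isClosed_setOf_posSemidef.preimage (continuous_tensorId_ofMatrixUnits M))
      (isClosed_iInter fun M => isClosed_eq ?_ continuous_const)
    refine Continuous.matrix_trace ?_
    simp only [ofMatrixUnits, LinearMap.coe_mk, AddHom.coe_mk]
    fun_prop
  · rw [mem_closedBall_zero_iff]
    have hc : IsChannel (ofMatrixUnits c) := hc
    -- `v` is the unnormalized maximally entangled vector and `C` the Choi matrix. `C` is positive
    -- with trace `card n`, which bounds its entries, the coefficients `c`.
    set v : n × n → ℂ := fun p => if p.1 = p.2 then 1 else 0 with hv
    set C := tensorId n (ofMatrixUnits c) (Matrix.vecMulVec v (star v)) with hC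
    have hCps : C.PosSemidef := hc.tensorId_posSemidef (Matrix.posSemidef_vecMulVec_self_star v)
    have hCc : C (x, i) (y, j) = c i j x y := by
      simp [hC, tensorId, ofMatrixUnits, Matrix.vecMulVec_apply, hv,
        apply_ite (starRingEnd ℂ), ite_smul]
    have htr : C.trace = Fintype.card n := by
      have := hc.trace_tensorId_mul (Matrix.vecMulVec v (star v)) (1 : Matrix n n ℂ)
      rw [Matrix.one_kronecker_one, Matrix.one_kronecker_one, mul_one, mul_one] at this
      rw [hC, this, Matrix.trace_vecMulVec]
      simp [dotProduct, Fintype.sum_prod_type, hv]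
    have := norm_apply_le_trace_re hCps (x, i) (y, j)
    rwa [htr, hCc, Complex.natCast_re] at this

/-- The channel that discards its input and prepares a fixed basis state; it makes the compact set
of channels nonempty. -/
theorem exists_isChannel [DecidableEq m] [Nonempty m] :
    ∃ Φ : Matrix n n ℂ →ₗ[ℂ] Matrix m m ℂ, IsChannel Φ := by
  classical
  obtain ⟨a⟩ := ‹Nonempty m›
  refine ⟨(Matrix.traceLinearMap n ℂ ℂ).smulRight (Matrix.single a a 1), fun k M hM => ?_,
    fun M => by simp⟩
  have : tensorId (Fin k) ((Matrix.traceLinearMap n ℂ ℂ).smulRight (Matrix.single a a (1 : ℂ))) M =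
      Matrix.single a a 1 ⊗ₖ traceSnd (M.submatrix Prod.swap Prod.swap) := by
    ext x y
    simp [tensorId, traceSnd, Matrix.trace, mul_comm]
  rw [this]
  refine Matrix.PosSemidef.kronecker ?_ (traceSnd_posSemidef (hM.submatrix _))
  rw [← Matrix.diagonal_single]
  exact Matrix.PosSemidef.diagonal (Pi.single_nonneg.2 zero_le_one)

end Channels

/-! ### Douglas factorization -/

section Factorization

variable {a r : Type*} [Fintype a] [Fintype r]

theorem norm_sq_toLp_mulVec (M : Matrix r a ℂ) (v : a → ℂ) :
    ((‖WithLp.toLp 2 (M *ᵥ v)‖ ^ 2 : ℝ) : ℂ) = star v ⬝ᵥ (Mᴴ * M) *ᵥ v := by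
  have := inner_self_eq_norm_sq_to_K (𝕜 := ℂ) (WithLp.toLp 2 (M *ᵥ v))
  rw [EuclideanSpace.inner_eq_star_dotProduct] at this
  rw [← Matrix.mulVec_mulVec, Matrix.dotProduct_mulVec, ← Matrix.star_mulVec, dotProduct_comm]
  push_cast
  exact this.symm

theorem posSemidef_sub_iff_norm_le {m : Type*} [Fintype m] (M : Matrix r a ℂ)
    (N : Matrix m a ℂ) :
    (Mᴴ * M - Nᴴ * N).PosSemidef ↔
      ∀ v : a → ℂ, ‖WithLp.toLp 2 (N *ᵥ v)‖ ≤ ‖WithLp.toLp 2 (M *ᵥ v)‖ := by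
  have h : ∀ v : a → ℂ, star v ⬝ᵥ (Mᴴ * M - Nᴴ * N) *ᵥ v =
      ((‖WithLp.toLp 2 (M *ᵥ v)‖ ^ 2 - ‖WithLp.toLp 2 (N *ᵥ v)‖ ^ 2 : ℝ) : ℂ) := fun v => by
    rw [Matrix.sub_mulVec, dotProduct_sub, ← norm_sq_toLp_mulVec, ← norm_sq_toLp_mulVec]
    push_cast
    rfl
  rw [Matrix.posSemidef_iff_dotProduct_mulVec]
  simp only [h, Complex.zero_le_real, sub_nonneg]
  refine ⟨fun H v => le_of_sq_le_sq (H.2 v) (norm_nonneg _), fun H => ⟨?_, fun v => ?_⟩⟩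
  · exact (Matrix.isHermitian_conjTranspose_mul_self M).sub
      (Matrix.isHermitian_conjTranspose_mul_self N)
  · exact pow_le_pow_left₀ (norm_nonneg _) (H v) 2

/-- Douglas' factorization: an operator dominated by `M M†` is of the form `M S M†` with
`0 ≤ S ≤ 1`. -/
theorem exists_eq_mul_mul_conjTranspose [DecidableEq a] [DecidableEq r] {M : Matrix a r ℂ}
    {σ : Matrix a a ℂ} (hσ : σ.PosSemidef) (hle : (M * Mᴴ - σ).PosSemidef) :
    ∃ S : Matrix r r ℂ, S.PosSemidef ∧ (1 - S).PosSemidef ∧ σ = M * S * Mᴴ := by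
  obtain ⟨b, rfl⟩ := CStarAlgebra.nonneg_iff_eq_star_mul_self.mp hσ.nonneg
  rw [Matrix.star_eq_conjTranspose] at hle ⊢
  have hle' := (posSemidef_sub_iff_norm_le Mᴴ b).1 (by rwa [Matrix.conjTranspose_conjTranspose])
  set f := Matrix.toEuclideanLin Mᴴ with hf
  set g := Matrix.toEuclideanLin b with hg
  have hfg : ∀ v, ‖g v‖ ≤ ‖f v‖ := fun v => hle' v.ofLp
  -- Domination makes `f v ↦ g v` a well-defined contraction on the range of `f`; composing with the
  -- orthogonal projection extends it to the whole space.
  have hker : LinearMap.ker f ≤ LinearMap.ker g := fun v hv => by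
    rw [LinearMap.mem_ker] at hv ⊢
    simpa [hv] using hfg v
  set h := (LinearMap.ker f).liftQ g hker ∘ₗ f.quotKerEquivRange.symm.toLinearMap with hh
  have hhf : ∀ v, h ⟨f v, LinearMap.mem_range_self f v⟩ = g v := fun v => by
    simp [hh, LinearMap.quotKerEquivRange_symm_apply_image]
  have hhn : ∀ y, ‖h y‖ ≤ ‖y‖ := by
    rintro ⟨_, v, rfl⟩
    rw [hhf]
    exact hfg v
  set W := h ∘ₗ (LinearMap.range f).orthogonalProjectionOnto.toLinearMap with hW
  have hWn : ∀ y, ‖W y‖ ≤ ‖y‖ := fun y =>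
    (hhn _).trans (Submodule.norm_orthogonalProjectionOnto_apply_le _ y)
  have hWf : ∀ v, W (f v) = g v := fun v => by
    rw [hW, LinearMap.comp_apply, ← hhf]
    congr 1
    exact Submodule.orthogonalProjectionOnto_mem_subspace_eq_self
      (⟨f v, LinearMap.mem_range_self f v⟩ : LinearMap.range f)
  obtain ⟨w, hw⟩ := (Matrix.toEuclideanLin (𝕜 := ℂ) (m := a) (n := r)).surjective W
  have hwM : w * Mᴴ = b := by
    apply (Matrix.toEuclideanLin (𝕜 := ℂ) (m := a) (n := a)).injective
    ext1 v
    rw [← hg, ← hWf, ← hw, hf]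
    simp [Matrix.toLpLin_apply]
  refine ⟨wᴴ * w, Matrix.posSemidef_conjTranspose_mul_self w, ?_, ?_⟩
  · have := (posSemidef_sub_iff_norm_le (1 : Matrix r r ℂ) w).2 fun v => by
      rw [Matrix.one_mulVec]
      have := hWn (WithLp.toLp 2 v)
      rw [← hw] at this
      exact this
    simpa using this
  · rw [← hwM, Matrix.conjTranspose_mul, Matrix.conjTranspose_conjTranspose]
    simp only [Matrix.mul_assoc]

end Factorization

/-! ### Existence of the optimal decomposition and recovery -/

section Extrema

variable {n : Type*} [Fintype n]

/-- Normalize by the trace. A positive operator of trace zero vanishes, and then `ρ` serves as a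
filler with weight zero. -/
theorem exists_isDensity_smul_eq {ρ σ : Matrix n n ℂ} (hρ : IsDensity ρ) (hσ : σ.PosSemidef) :
    ∃ τ, IsDensity τ ∧ ((σ.trace.re : ℝ) : ℂ) • τ = σ := by
  have htr := Complex.nonneg_iff.1 hσ.trace_nonneg
  have hre : ((σ.trace.re : ℝ) : ℂ) = σ.trace := Complex.ext rfl htr.2
  rcases eq_or_ne σ.trace 0 with h | h
  · exact ⟨ρ, hρ, by rw [hre, h, (hσ.trace_eq_zero_iff).1 h, zero_smul]⟩
  · refine ⟨σ.trace⁻¹ • σ, ⟨hσ.smul ?_, ?_⟩, ?_⟩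
    · rw [← hre, ← Complex.ofReal_inv]
      exact_mod_cast inv_nonneg.2 htr.1
    · rw [Matrix.trace_smul, smul_eq_mul, inv_mul_cancel₀ h]
    · rw [hre, smul_smul, mul_inv_cancel₀ h, one_smul]

/-- The mean absolute deviation of a linear functional over the decompositions of a density
operator has a maximum, which is attained by a decomposition into two parts. -/
theorem exists_isGreatest_decomposition {ρ : Matrix n n ℂ} (hρ : IsDensity ρ)
    (f : Matrix n n ℂ →ₗ[ℝ] ℝ) :
    ∃ σ : Matrix n n ℂ, σ.PosSemidef ∧ (ρ - σ).PosSemidef ∧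
      IsGreatest {x | ∃ (N : ℕ) (p : Fin N → ℝ) (τ : Fin N → Matrix n n ℂ),
        IsDecomposition ρ p τ ∧ x = ∑ j, p j * |f (τ j) - f ρ|}
        (2 * (f σ - σ.trace.re * f ρ)) := by
  -- Centring `f` by a multiple of the trace gives a linear `g` with `g ρ = 0` that is the deviation
  -- on density operators.
  set g : Matrix n n ℂ →ₗ[ℝ] ℝ :=
    f - (f ρ) • (Complex.reLm ∘ₗ (Matrix.traceLinearMap n ℝ ℂ)) with hg
  have hgv : ∀ σ, g σ = f σ - σ.trace.re * f ρ := fun σ => by simp [hg, mul_comm]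
  have hgρ : g ρ = 0 := by simp [hgv, hρ.2]
  have hgd : ∀ τ, IsDensity τ → f τ - f ρ = g τ := fun τ h => by simp [hgv, h.2]
  have hcont : Continuous g := g.continuous_of_finiteDimensional
  obtain ⟨σ, hσ, hmax⟩ := (isCompact_setOf_posSemidef_le (ρ := ρ)).exists_isMaxOn
    ⟨0, .zero, by simpa using hρ.1⟩ hcont.continuousOn
  have hsmul : ∀ (z : ℝ) (τ : Matrix n n ℂ), g ((z : ℂ) • τ) = z * g τ := fun z τ => by
    rw [← smul_eq_mul, ← map_smul]; congr 1
  refine ⟨σ, hσ.1, hσ.2, ?_, ?_⟩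
  · obtain ⟨τ₁, h₁, e₁⟩ := exists_isDensity_smul_eq hρ hσ.1
    obtain ⟨τ₂, h₂, e₂⟩ := exists_isDensity_smul_eq hρ hσ.2
    have hp₁ := (Complex.nonneg_iff.1 hσ.1.trace_nonneg).1
    have hp₂ := (Complex.nonneg_iff.1 hσ.2.trace_nonneg).1
    refine ⟨2, ![σ.trace.re, (ρ - σ).trace.re], ![τ₁, τ₂], ⟨?_, ?_, ?_, ?_⟩, ?_⟩
    · simpa [Fin.forall_fin_two] using ⟨hp₁, by simpa using hp₂⟩
    · simp [hρ.2]
    · simpa [Fin.forall_fin_two] using ⟨h₁, h₂⟩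
    · simp only [Fin.sum_univ_two, Matrix.cons_val_zero, Matrix.cons_val_one, e₁, e₂]
      abel
    · have hσ0 : 0 ≤ g σ := by
        simpa using hmax (show (0 : Matrix n n ℂ) ∈ _ from ⟨.zero, by simpa using hρ.1⟩)
      simp only [Fin.sum_univ_two, Matrix.cons_val_zero, Matrix.cons_val_one, hgd _ h₁,
        hgd _ h₂]
      have k₁ : σ.trace.re * |g τ₁| = |g σ| := by
        conv_rhs => rw [← e₁, hsmul, abs_mul, abs_of_nonneg hp₁]
      have k₂ : (ρ - σ).trace.re * |g τ₂| = |g (ρ - σ)| := by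
        conv_rhs => rw [← e₂, hsmul, abs_mul, abs_of_nonneg hp₂]
      rw [k₁, k₂, map_sub, hgρ, zero_sub, abs_neg, abs_of_nonneg hσ0, ← hgv]
      ring
  · rintro _ ⟨N, p, τ, hd, rfl⟩
    have hsum : ∑ j, p j * g (τ j) = 0 := by
      rw [← hgρ, ← hd.sum_smul, map_sum]
      simp only [hsmul]
    -- This is `|x| = 2 x⁺ - x`. The terms `-x` sum to zero, and the parts with `g ≥ 0` add up to an
    -- operator between `0` and `ρ`.
    have habs : ∀ j, p j * |f (τ j) - f ρ| =
        2 * (if 0 ≤ g (τ j) then p j * g (τ j) else 0) - p j * g (τ j) := fun j => by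
      rw [hgd _ (hd.isDensity j)]
      split_ifs with h
      · rw [abs_of_nonneg h]; ring
      · rw [abs_of_neg (not_le.1 h)]; ring
    have hps : ∀ j, ((p j : ℂ) • τ j).PosSemidef := fun j =>
      (hd.isDensity j).1.smul (by exact_mod_cast hd.nonneg j)
    have hle : g (∑ j with 0 ≤ g (τ j), (p j : ℂ) • τ j) ≤ g σ := by
      refine hmax ⟨Matrix.posSemidef_sum _ fun j _ => hps j, ?_⟩
      rw [← hd.sum_smul, ← Finset.sum_filter_add_sum_filter_not Finset.univ
        (fun j => 0 ≤ g (τ j)), add_sub_cancel_left]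
      exact Matrix.posSemidef_sum _ fun j _ => hps j
    simp only [habs]
    rw [Finset.sum_sub_distrib, hsum, sub_zero, ← Finset.mul_sum, ← Finset.sum_filter, ← hgv]
    rw [map_sum] at hle
    simp only [hsmul] at hle
    linarith

/-- The best recovery of a purified state exists. -/
theorem exists_isLeast_recovery {m r : Type*} [Fintype m] [Fintype r] [DecidableEq m]
    [DecidableEq r] [Nonempty m] (ψ : EuclideanSpace ℂ (m × r))
    {τ : Matrix (n × r) (n × r) ℂ} (hτ : τ.PosSemidef) :
    ∃ d, IsLeast {d | ∃ R : Matrix n n ℂ →ₗ[ℂ] Matrix m m ℂ, IsChannel R ∧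
      d = purifiedDistance (pureState ψ) (tensorId r R τ)} d := by
  classical
  obtain ⟨Φ, hΦ⟩ := exists_isChannel (n := n) (m := m)
  -- Because the target is pure, the error is an explicit continuous function of the channel's
  -- coefficients.
  have hcont : Continuous fun c : n → n → Matrix m m ℂ =>
      √(1 - (tensorId r (ofMatrixUnits c) τ * pureState ψ).trace.re) := by
    have := continuous_tensorId_ofMatrixUnits (m := m) τ
    refine Real.continuous_sqrt.comp (continuous_const.sub (Complex.continuous_re.comp ?_))
    exact (this.matrix_mul continuous_const).matrix_trace
  obtain ⟨c, hc, hmin⟩ := (isCompact_setOf_isChannel (n := n) (m := m)).exists_isMinOn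
    ⟨fun i j => Φ (Matrix.single i j 1), by rwa [Set.mem_ofPred_eq, ofMatrixUnits_single]⟩
    hcont.continuousOn
  refine ⟨_, ⟨ofMatrixUnits c, hc, rfl⟩, ?_⟩
  rintro _ ⟨R, hR, rfl⟩
  have hc' : IsChannel (ofMatrixUnits c) := hc
  rw [purifiedDistance_pureState ψ (hc'.tensorId_posSemidef hτ),
    purifiedDistance_pureState ψ (hR.tensorId_posSemidef hτ), ← ofMatrixUnits_single R]
  exact hmin (show IsChannel _ by rwa [ofMatrixUnits_single])

end Extrema

/-! ### Conservation law and the final state -/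

section Evolution

variable {A B A' B' RA RB : Type*} [Fintype A] [Fintype B] [Fintype B']
  [Fintype RA] [Fintype RB] [DecidableEq RA] [DecidableEq RB]

theorem evolution_add (U : Matrix (A' × B') (A × B) ℂ) (ρB : Matrix B B ℂ) (ξ η : Matrix A A ℂ) :
    evolution U ρB (ξ + η) = evolution U ρB ξ + evolution U ρB η := by
  ext i j
  simp [evolution, Matrix.add_kronecker, Matrix.mul_add, Matrix.add_mul, traceSnd,
    Finset.sum_add_distrib]

theorem evolution_smul (U : Matrix (A' × B') (A × B) ℂ) (ρB : Matrix B B ℂ) (z : ℝ)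
    (ξ : Matrix A A ℂ) : evolution U ρB (z • ξ) = z • evolution U ρB ξ := by
  ext i j
  simp [evolution, Matrix.smul_kronecker, traceSnd, Finset.smul_sum]

/-- The mean loss `⟨X_A⟩_ξ - ⟨X_{A'}⟩_{ℰ(ξ)}` of the local quantity. -/
def meanLoss [Fintype A'] (U : Matrix (A' × B') (A × B) ℂ) (ρB : Matrix B B ℂ) (XA : Matrix A A ℂ)
    (XA' : Matrix A' A' ℂ) : Matrix A A ℂ →ₗ[ℝ] ℝ where
  toFun ξ := expect XA ξ - expect XA' (evolution U ρB ξ)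
  map_add' ξ η := by
    simp only [expect, evolution_add, Matrix.mul_add, Matrix.trace_add, Complex.add_re]
    ring
  map_smul' z ξ := by
    simp only [expect, evolution_smul, Matrix.mul_smul, Matrix.trace_smul, Complex.smul_re,
      smul_eq_mul, RingHom.id_apply]
    ring

/-- What is lost on `A` from an operator of zero trace is found on `B'`. -/
theorem meanLoss_eq_of_trace_eq_zero [Fintype A'] [DecidableEq A] [DecidableEq B]
    [DecidableEq A'] [DecidableEq B'] {U : Matrix (A' × B') (A × B) ℂ} (hU : Uᴴ * U = 1)
    {XA : Matrix A A ℂ} {XB : Matrix B B ℂ} {XA' : Matrix A' A' ℂ} {XB' : Matrix B' B' ℂ}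
    (hcons : U * (XA ⊗ₖ (1 : Matrix B B ℂ) + (1 : Matrix A A ℂ) ⊗ₖ XB) * Uᴴ =
      XA' ⊗ₖ (1 : Matrix B' B' ℂ) + (1 : Matrix A' A' ℂ) ⊗ₖ XB')
    {ρB : Matrix B B ℂ} (hρB : ρB.trace = 1) {ξ : Matrix A A ℂ} (hξ : ξ.trace = 0) (y : ℂ) :
    meanLoss U ρB XA XA' ξ =
      (U * (ξ ⊗ₖ ρB) * Uᴴ * ((1 : Matrix A' A' ℂ) ⊗ₖ (XB' - y • 1))).trace.re := by
  set K := ξ ⊗ₖ ρB with hK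
  set G := U * K * Uᴴ with hG
  have hKtr : K.trace = 0 := by rw [hK, Matrix.trace_kronecker, hξ, zero_mul]
  have hGtr : G.trace = 0 := by
    rw [hG, Matrix.trace_mul_comm, ← Matrix.mul_assoc, hU, Matrix.one_mul, hKtr]
  have h1 : (G * (XA' ⊗ₖ (1 : Matrix B' B' ℂ) + (1 : Matrix A' A' ℂ) ⊗ₖ XB')).trace =
      (K * (XA ⊗ₖ (1 : Matrix B B ℂ) + (1 : Matrix A A ℂ) ⊗ₖ XB)).trace := by
    rw [← hcons, hG]
    have : U * K * Uᴴ * (U * (XA ⊗ₖ (1 : Matrix B B ℂ) + (1 : Matrix A A ℂ) ⊗ₖ XB) * Uᴴ) =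
        U * (K * (XA ⊗ₖ (1 : Matrix B B ℂ) + (1 : Matrix A A ℂ) ⊗ₖ XB)) * Uᴴ := by
      simp only [Matrix.mul_assoc]
      rw [← Matrix.mul_assoc Uᴴ U, hU, Matrix.one_mul]
    rw [this, Matrix.trace_mul_comm, ← Matrix.mul_assoc, hU, Matrix.one_mul]
  have h2 : (K * (XA ⊗ₖ (1 : Matrix B B ℂ) + (1 : Matrix A A ℂ) ⊗ₖ XB)).trace =
      (XA * ξ).trace := by
    rw [Matrix.mul_add, hK, ← Matrix.mul_kronecker_mul, ← Matrix.mul_kronecker_mul,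
      Matrix.trace_add, Matrix.trace_kronecker, Matrix.trace_kronecker, Matrix.mul_one,
      Matrix.mul_one, hρB, hξ, Matrix.trace_mul_comm]
    ring
  have h3 : (XA' * evolution U ρB ξ).trace = (G * (XA' ⊗ₖ (1 : Matrix B' B' ℂ))).trace := by
    rw [Matrix.trace_mul_comm, evolution, trace_traceSnd_mul]
  -- `G` has trace zero, so the shift `y` is free; it is chosen later to make the second moment on
  -- `B'` small.
  have h4 : (G * ((1 : Matrix A' A' ℂ) ⊗ₖ (XB' - y • 1))).trace =
      (G * ((1 : Matrix A' A' ℂ) ⊗ₖ XB')).trace := by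
    rw [sub_eq_add_neg, ← neg_smul, Matrix.kronecker_add, Matrix.kronecker_smul,
      Matrix.one_kronecker_one, Matrix.mul_add, Matrix.mul_smul, Matrix.mul_one,
      Matrix.trace_add, Matrix.trace_smul, hGtr, smul_zero, add_zero]
  rw [Matrix.mul_add, Matrix.trace_add, h2] at h1
  change (XA * ξ).trace.re - (XA' * evolution U ρB ξ).trace.re = _
  rw [h4, h3, ← h1, Complex.add_re]
  ring

theorem kronecker_one_conj_apply {m n r : Type*} [Fintype n] [Fintype r] [DecidableEq r]
    (U : Matrix m n ℂ) (N : Matrix (n × r) (n × r) ℂ) (x y : m) (p q : r) :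
    ((U ⊗ₖ (1 : Matrix r r ℂ)) * N * (U ⊗ₖ (1 : Matrix r r ℂ))ᴴ) (x, p) (y, q) =
      (U * Matrix.of (fun i j => N (i, p) (j, q)) * Uᴴ) x y := by
  simp only [Matrix.mul_apply, Matrix.conjTranspose_apply, Matrix.kronecker_apply,
    Matrix.one_apply, Matrix.of_apply, Fintype.sum_prod_type, mul_ite, mul_one, mul_zero, ite_mul,
    zero_mul, apply_ite star, star_zero, Finset.sum_ite_eq, Finset.mem_univ, if_true]

theorem totalFinalState_apply {B' : Type*} (U : Matrix (A' × B') (A × B) ℂ)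
    (ρA : Matrix (A × RA) (A × RA) ℂ) (ρB : Matrix (B × RB) (B × RB) ℂ)
    (x y : A' × B') (p q : RA × RB) :
    totalFinalState U ρA ρB (x, p) (y, q) =
      (U * Matrix.of (fun i j : A × B => ρA (i.1, p.1) (j.1, q.1) * ρB (i.2, p.2) (j.2, q.2)) *
        Uᴴ) x y := by
  rw [totalFinalState, kronecker_one_conj_apply]
  rfl

/-- The state of `((A' R_B) R_A) B'` before the recovery. -/
def reorderedFinalState {B' : Type*} (U : Matrix (A' × B') (A × B) ℂ)
    (ρA : Matrix (A × RA) (A × RA) ℂ) (ρB : Matrix (B × RB) (B × RB) ℂ) :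
    Matrix (((A' × RB) × RA) × B') (((A' × RB) × RA) × B') ℂ :=
  (totalFinalState U ρA ρB).submatrix (fun x => ((x.1.1.1, x.2), (x.1.2, x.1.1.2)))
    fun x => ((x.1.1.1, x.2), (x.1.2, x.1.1.2))

theorem reorderedFinalState_posSemidef [Fintype A'] (U : Matrix (A' × B') (A × B) ℂ)
    {ρA : Matrix (A × RA) (A × RA) ℂ} {ρB : Matrix (B × RB) (B × RB) ℂ}
    (hρA : ρA.PosSemidef) (hρB : ρB.PosSemidef) : (reorderedFinalState U ρA ρB).PosSemidef :=
  (((hρA.kronecker hρB).submatrix _).mul_mul_conjTranspose_same _).submatrix _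

/-- Expectation values on `R_A B'` in the final state, as expectation values on `A' B'`. -/
theorem trace_reorderedFinalState_mul [Fintype A'] [DecidableEq A] [DecidableEq A'] (U : Matrix (A' × B') (A × B) ℂ)
    (ρA : Matrix (A × RA) (A × RA) ℂ) (ρB : Matrix (B × RB) (B × RB) ℂ)
    (T : Matrix RA RA ℂ) (Y : Matrix B' B' ℂ) :
    ((reorderedFinalState U ρA ρB).submatrix (Equiv.prodAssoc (A' × RB) RA B').symm
        (Equiv.prodAssoc (A' × RB) RA B').symm * ((1 : Matrix (A' × RB) (A' × RB) ℂ) ⊗ₖ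
          (T ⊗ₖ Y))).trace =
      (U * (traceSnd (ρA * ((1 : Matrix A A ℂ) ⊗ₖ T)) ⊗ₖ traceSnd ρB) * Uᴴ *
        ((1 : Matrix A' A' ℂ) ⊗ₖ Y)).trace := by
  have hG : ∀ x y, (U * (traceSnd (ρA * ((1 : Matrix A A ℂ) ⊗ₖ T)) ⊗ₖ traceSnd ρB) * Uᴴ) x y =
      ∑ r, ∑ r₂, ∑ s, T r₂ r * totalFinalState U ρA ρB (x, (r, s)) (y, (r₂, s)) := fun x y => by
    have : traceSnd (ρA * ((1 : Matrix A A ℂ) ⊗ₖ T)) ⊗ₖ traceSnd ρB =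
        ∑ r, ∑ r₂, ∑ s, T r₂ r • Matrix.of (fun i j : A × B =>
          ρA (i.1, r) (j.1, r₂) * ρB (i.2, s) (j.2, s)) := by
      ext i j
      simp only [Matrix.sum_apply, Matrix.kronecker_apply, traceSnd, Matrix.of_apply,
        Matrix.smul_apply, smul_eq_mul, Matrix.mul_apply, Fintype.sum_prod_type,
        Matrix.one_apply, ite_mul, one_mul, zero_mul, mul_ite, mul_zero, Finset.sum_ite_irrel,
        Finset.sum_const_zero, Finset.sum_ite_eq', Finset.mem_univ, if_true]
      rw [Matrix.kronecker_apply, Matrix.of_apply, Matrix.of_apply, Finset.sum_mul]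
      refine Finset.sum_congr rfl fun r _ => ?_
      rw [Finset.sum_mul]
      refine Finset.sum_congr rfl fun r₂ _ => ?_
      rw [Finset.mul_sum]
      exact Finset.sum_congr rfl fun s _ => by ring
    rw [this]
    simp only [totalFinalState_apply, Matrix.mul_sum, Matrix.sum_mul, Matrix.mul_smul,
      Matrix.smul_mul, Matrix.sum_apply, Matrix.smul_apply, smul_eq_mul]
  rw [trace_mul_one_kronecker, trace_mul_one_kronecker]
  simp only [hG]
  simp only [reorderedFinalState, Matrix.submatrix_apply, Equiv.prodAssoc_symm_apply,
    Fintype.sum_prod_type, Matrix.kronecker_apply, Finset.sum_mul]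
  rw [Finset.sum_comm]
  refine Finset.sum_congr rfl fun b _ => ?_
  refine (Finset.sum_congr rfl fun r _ => Finset.sum_comm).trans (Finset.sum_comm.trans ?_)
  refine Finset.sum_congr rfl fun b₂ _ => ?_
  refine (Finset.sum_congr rfl fun r _ => Finset.sum_comm).trans (Finset.sum_comm.trans ?_)
  refine Finset.sum_congr rfl fun a _ => Finset.sum_congr rfl fun r _ =>
    Finset.sum_congr rfl fun r₂ _ => Finset.sum_congr rfl fun s _ => by ring

end Evolution

/-! ### Tensoring with the identity -/

section KroneckerOne

variable {m n : Type*} [DecidableEq m] [DecidableEq n]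

theorem sub_smul_one_kronecker_one (X : Matrix m m ℂ) (c : ℂ) :
    (X - c • 1) ⊗ₖ (1 : Matrix n n ℂ) = X ⊗ₖ (1 : Matrix n n ℂ) - c • 1 := by
  rw [sub_eq_add_neg, ← neg_smul, Matrix.add_kronecker, Matrix.smul_kronecker,
    Matrix.one_kronecker_one, neg_smul, ← sub_eq_add_neg]

theorem one_kronecker_sub_smul_one (X : Matrix n n ℂ) (c : ℂ) :
    (1 : Matrix m m ℂ) ⊗ₖ (X - c • 1) = (1 : Matrix m m ℂ) ⊗ₖ X - c • 1 := by
  rw [sub_eq_add_neg, ← neg_smul, Matrix.kronecker_add, Matrix.kronecker_smul,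
    Matrix.one_kronecker_one, neg_smul, ← sub_eq_add_neg]

theorem posSemidef_smul_one_sub_sq_kronecker_one [Fintype m] [Fintype n] {X : Matrix m m ℂ} {k : ℂ}
    (h : (k • (1 : Matrix m m ℂ) - X * X).PosSemidef) :
    (k • (1 : Matrix (m × n) (m × n) ℂ) -
      X ⊗ₖ (1 : Matrix n n ℂ) * X ⊗ₖ (1 : Matrix n n ℂ)).PosSemidef := by
  have := h.kronecker (Matrix.PosSemidef.one (n := n) (R := ℂ))
  rwa [← neg_sub, ← neg_one_smul ℂ, Matrix.smul_kronecker, sub_smul_one_kronecker_one,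
    neg_one_smul, neg_sub, ← mul_one (1 : Matrix n n ℂ), Matrix.mul_kronecker_mul] at this

theorem isHermitian_kronecker {m n : Type*} {M : Matrix m m ℂ} {N : Matrix n n ℂ}
    (hM : M.IsHermitian) (hN : N.IsHermitian) : (M ⊗ₖ N).IsHermitian := by
  rw [Matrix.IsHermitian, Matrix.conjTranspose_kronecker, hM.eq, hN.eq]

theorem trace_submatrix_equiv_mul {m n : Type*} [Fintype m] [Fintype n] (e : m ≃ n)
    (M : Matrix n n ℂ) (Z : Matrix m m ℂ) :
    (M.submatrix e e * Z).trace = (M * Z.submatrix e.symm e.symm).trace := by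
  simp only [Matrix.trace, Matrix.diag, Matrix.mul_apply, Matrix.submatrix_apply]
  refine Fintype.sum_equiv e _ _ fun i => Fintype.sum_equiv e _ _ fun j => ?_
  simp

end KroneckerOne

/-! ### Second moment of the conserved quantity on `B'` -/

section Uncertainty

theorem weightedNorm_le_of_sq_le {n : Type*} [Fintype n] [DecidableEq n] {ρ Z : Matrix n n ℂ}
    (hρ : IsDensity ρ) (hZ : Z.IsHermitian) {c : ℝ} (hc : 0 ≤ c)
    (h : (((c : ℂ) ^ 2) • (1 : Matrix n n ℂ) - Z * Z).PosSemidef) : weightedNorm ρ Z ≤ c := by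
  have h1 : weightedNorm ρ Z ≤ weightedNorm ρ ((c : ℂ) • 1) := by
    apply weightedNorm_le_of_posSemidef hρ.1
    rw [hZ.eq]
    convert h using 2
    simp only [Matrix.conjTranspose_smul, Matrix.conjTranspose_one, smul_mul_smul_comm, mul_one,
      Complex.star_def, Complex.conj_ofReal, pow_two]
  refine h1.trans_eq ?_
  rw [weightedNorm]
  have : ((c : ℂ) • (1 : Matrix n n ℂ) * ρ * ((c : ℂ) • (1 : Matrix n n ℂ))ᴴ).trace =
      ((c ^ 2 : ℝ) : ℂ) := by
    simp [smul_smul, hρ.2, pow_two]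
  rw [this, Complex.ofReal_re, Real.sqrt_sq hc]

theorem IsDensity.kronecker {m n : Type*} [Fintype m] [Fintype n] {ρ : Matrix m m ℂ}
    {σ : Matrix n n ℂ} (hρ : IsDensity ρ) (hσ : IsDensity σ) : IsDensity (ρ ⊗ₖ σ) :=
  ⟨hρ.1.kronecker hσ.1, by rw [Matrix.trace_kronecker, hρ.2, hσ.2, one_mul]⟩

theorem IsDensity.traceSnd {m n : Type*} [Fintype m] [Fintype n] {ρ : Matrix (m × n) (m × n) ℂ}
    (hρ : IsDensity ρ) : IsDensity (traceSnd ρ) :=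
  ⟨traceSnd_posSemidef hρ.1, by rw [trace_traceSnd, hρ.2]⟩

theorem isDensity_pureState {n : Type*} [Fintype n] {v : EuclideanSpace ℂ n} (hv : ‖v‖ = 1) :
    IsDensity (pureState v) :=
  ⟨posSemidef_pureState v, by rw [trace_pureState, hv]; simp⟩

theorem isHermitian_sub_real_smul_one {n : Type*} [Fintype n] [DecidableEq n] {X : Matrix n n ℂ}
    (hX : X.IsHermitian) (c : ℝ) : (X - (c : ℂ) • 1).IsHermitian := by
  simp [Matrix.IsHermitian, hX.eq]

variable {A B A' B' RB : Type*} [Fintype A] [Fintype B] [Fintype A'] [Fintype B'] [Fintype RB]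
  [DecidableEq A] [DecidableEq B] [DecidableEq A'] [DecidableEq B'] [DecidableEq RB]

/-- The fluctuation of the conserved quantity on `B'` after the evolution is bounded by that on
`B` before it, up to the sizes of the local quantities of `A` and `A'`. -/
theorem exists_sqrt_trace_le {U : Matrix (A' × B') (A × B) ℂ} (hU : Uᴴ * U = 1) (hU' : U * Uᴴ = 1)
    {XA : Matrix A A ℂ} {XB : Matrix B B ℂ} {XA' : Matrix A' A' ℂ} {XB' : Matrix B' B' ℂ}
    (hXA : XA.IsHermitian) (hXA' : XA'.IsHermitian) (hXB' : XB'.IsHermitian)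
    (hcons : U * (XA ⊗ₖ (1 : Matrix B B ℂ) + (1 : Matrix A A ℂ) ⊗ₖ XB) * Uᴴ =
      XA' ⊗ₖ (1 : Matrix B' B' ℂ) + (1 : Matrix A' A' ℂ) ⊗ₖ XB')
    {ρA : Matrix A A ℂ} (hρA : IsDensity ρA) {ρBRB : Matrix (B × RB) (B × RB) ℂ}
    (hρB : IsDensity ρBRB) (b : ℝ) :
    ∃ y : ℝ, √(U * (ρA ⊗ₖ traceSnd ρBRB) * Uᴴ * ((1 : Matrix A' A' ℂ) ⊗ₖ
        ((XB' - (y : ℂ) • 1) * (XB' - (y : ℂ) • 1)))).trace.re ≤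
      weightedNorm ρBRB (XB ⊗ₖ (1 : Matrix RB RB ℂ) - (b : ℂ) • 1) +
        (eigenvalueSpread hXA + eigenvalueSpread hXA') / 2 := by
  obtain ⟨a, ha⟩ := exists_posSemidef_sq_sub_sq hXA
  obtain ⟨a', ha'⟩ := exists_posSemidef_sq_sub_sq hXA'
  -- With `a` and `a'` the midpoints of the local spectra, this shift makes `U† (1 ⊗ Y) U` equal to
  -- `(X_B - b) + (X_A - a) - U† (X_{A'} - a') U`.
  refine ⟨a + b - a', ?_⟩
  set ρ := ρA ⊗ₖ traceSnd ρBRB with hρdef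
  have hρ : IsDensity ρ := hρA.kronecker hρB.traceSnd
  set Y := XB' - ((a + b - a' : ℝ) : ℂ) • (1 : Matrix B' B' ℂ) with hY
  set ZA := (XA - (a : ℂ) • 1) ⊗ₖ (1 : Matrix B B ℂ) with hZA
  set ZB := (1 : Matrix A A ℂ) ⊗ₖ (XB - (b : ℂ) • 1) with hZB
  set ZA' := Uᴴ * ((XA' - (a' : ℂ) • 1) ⊗ₖ (1 : Matrix B' B' ℂ)) * U with hZA'
  have hYh : Y.IsHermitian := isHermitian_sub_real_smul_one hXB' _
  have hconj : ∀ N : Matrix (A' × B') (A' × B') ℂ,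
      Uᴴ * N * U * (Uᴴ * N * U) = Uᴴ * (N * N) * U := fun N => by
    simp only [Matrix.mul_assoc]
    rw [← Matrix.mul_assoc U Uᴴ, hU', Matrix.one_mul]
  have hZ : Uᴴ * ((1 : Matrix A' A' ℂ) ⊗ₖ Y) * U = ZB + ZA + -ZA' := by
    have h1 : XA ⊗ₖ (1 : Matrix B B ℂ) + (1 : Matrix A A ℂ) ⊗ₖ XB =
        Uᴴ * (XA' ⊗ₖ (1 : Matrix B' B' ℂ) + (1 : Matrix A' A' ℂ) ⊗ₖ XB') * U := by
      rw [← hcons]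
      simp only [Matrix.mul_assoc, hU, Matrix.mul_one]
      rw [← Matrix.mul_assoc, hU, Matrix.one_mul]
    rw [hZA, hZB, hZA', hY, sub_smul_one_kronecker_one, sub_smul_one_kronecker_one,
      one_kronecker_sub_smul_one, one_kronecker_sub_smul_one]
    rw [← eq_sub_iff_add_eq] at h1
    rw [h1]
    simp only [Matrix.mul_add, Matrix.add_mul, Matrix.mul_sub, Matrix.sub_mul, Matrix.mul_smul,
      Matrix.smul_mul, Matrix.mul_one, hU]
    push_cast
    module
  have hleft : √(U * ρ * Uᴴ * ((1 : Matrix A' A' ℂ) ⊗ₖ (Y * Y))).trace.re =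
      weightedNorm ρ (ZB + ZA + -ZA') := by
    rw [weightedNorm_eq, ← hZ]
    have hh : (Uᴴ * ((1 : Matrix A' A' ℂ) ⊗ₖ Y) * U)ᴴ = Uᴴ * ((1 : Matrix A' A' ℂ) ⊗ₖ Y) * U :=
      (Matrix.isHermitian_conjTranspose_mul_mul U (isHermitian_kronecker
        Matrix.isHermitian_one hYh)).eq
    rw [hh, hconj, ← Matrix.mul_kronecker_mul, Matrix.one_mul]
    congr 2
    rw [Matrix.mul_assoc, Matrix.mul_assoc, Matrix.trace_mul_comm, Matrix.mul_assoc,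
      Matrix.mul_assoc]
  have hB : weightedNorm ρ ZB =
      weightedNorm ρBRB (XB ⊗ₖ (1 : Matrix RB RB ℂ) - (b : ℂ) • 1) := by
    rw [weightedNorm_eq, weightedNorm_eq, ← sub_smul_one_kronecker_one, hZB,
      Matrix.conjTranspose_kronecker, Matrix.conjTranspose_kronecker, Matrix.conjTranspose_one,
      Matrix.conjTranspose_one, ← Matrix.mul_kronecker_mul, ← Matrix.mul_kronecker_mul,
      Matrix.mul_one, Matrix.mul_one, ← Matrix.mul_kronecker_mul, Matrix.mul_one,
      Matrix.trace_kronecker, hρA.2, one_mul, trace_traceSnd_mul]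
  have hA : weightedNorm ρ ZA ≤ eigenvalueSpread hXA / 2 := by
    refine weightedNorm_le_of_sq_le hρ (isHermitian_kronecker
      (isHermitian_sub_real_smul_one hXA a) Matrix.isHermitian_one)
      (div_nonneg (eigenvalueSpread_nonneg hXA) two_pos.le) ?_
    exact posSemidef_smul_one_sub_sq_kronecker_one ha
  have hA' : weightedNorm ρ ZA' ≤ eigenvalueSpread hXA' / 2 := by
    refine weightedNorm_le_of_sq_le hρ (Matrix.isHermitian_conjTranspose_mul_mul U
      (isHermitian_kronecker (isHermitian_sub_real_smul_one hXA' a') Matrix.isHermitian_one))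
      (div_nonneg (eigenvalueSpread_nonneg hXA') two_pos.le) ?_
    rw [hconj]
    have := (posSemidef_smul_one_sub_sq_kronecker_one (n := B') ha').conjTranspose_mul_mul_same U
    rwa [Matrix.mul_sub, Matrix.sub_mul, Matrix.mul_smul, Matrix.mul_one, Matrix.smul_mul,
      hU] at this
  rw [hleft]
  have t1 := weightedNorm_add_le hρ.1 (ZB + ZA) (-ZA')
  have t2 := weightedNorm_add_le hρ.1 ZB ZA
  rw [weightedNorm_neg] at t1
  rw [← hB]
  linarith

end Uncertainty

/-! ### Correlations obstruct recovery -/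

section Recovery

variable {A B A' B' RA RB : Type*} [Fintype A] [Fintype B] [Fintype A'] [Fintype B']
  [Fintype RA] [Fintype RB] [DecidableEq A] [DecidableEq B] [DecidableEq A'] [DecidableEq B']
  [DecidableEq RA] [DecidableEq RB]

/-- `2 (1 - T²) = (1 - T)(1 + T)(1 - T) + (1 + T)(1 - T)(1 + T)`. -/
theorem posSemidef_one_sub_sq {n : Type*} [Fintype n] [DecidableEq n] {T : Matrix n n ℂ}
    (h₁ : (1 - T).PosSemidef) (h₂ : (1 + T).PosSemidef) : (1 - T * T).PosSemidef := by
  have e₁ := h₂.mul_mul_conjTranspose_same (1 - T)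
  have e₂ := h₁.mul_mul_conjTranspose_same (1 + T)
  rw [h₁.isHermitian.eq] at e₁
  rw [h₂.isHermitian.eq] at e₂
  have := (e₁.add e₂).smul (show (0 : ℂ) ≤ 1 / 2 by norm_num [Complex.nonneg_iff])
  convert this using 1
  simp only [mul_sub, sub_mul, mul_add, add_mul, mul_one, one_mul]
  module

/-- Steering: with `ψ` read as a matrix `M` from `R_A` to `A`, an operator on the purifying system
produces `M Tᵀ M†` on `A`. -/
theorem traceSnd_pureState_mul {A RA : Type*} [Fintype A] [Fintype RA] [DecidableEq A]
    (ψ : EuclideanSpace ℂ (A × RA)) (T : Matrix RA RA ℂ) :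
    traceSnd (pureState ψ * ((1 : Matrix A A ℂ) ⊗ₖ T)) =
      Matrix.of (fun a r => ψ (a, r)) * Tᵀ * (Matrix.of fun a r => ψ (a, r))ᴴ := by
  ext a a₂
  simp only [traceSnd, pureState, Matrix.of_apply, Matrix.mul_apply, Matrix.kronecker_apply,
    Matrix.one_apply, Fintype.sum_prod_type, ite_mul, one_mul, zero_mul, mul_ite, mul_zero,
    Finset.sum_ite_irrel, Finset.sum_const_zero, Finset.sum_ite_eq', Finset.mem_univ, if_true,
    Matrix.transpose_apply, Matrix.conjTranspose_apply, Finset.sum_mul]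
  rw [Finset.sum_comm]
  exact Finset.sum_congr rfl fun r _ => Finset.sum_congr rfl fun r₂ _ => by ring

/-- A correlation between `R_A` and `B'` in the final state obstructs the recovery. -/
theorem abs_re_trace_le_purifiedDistance {ψ : EuclideanSpace ℂ (A × RA)} (hψ : ‖ψ‖ = 1)
    {ρB : Matrix (B × RB) (B × RB) ℂ} (hρB : IsDensity ρB)
    {U : Matrix (A' × B') (A × B) ℂ} (hU : Uᴴ * U = 1)
    {R : Matrix (A' × RB) (A' × RB) ℂ →ₗ[ℂ] Matrix A A ℂ} (hR : IsChannel R)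
    {T : Matrix RA RA ℂ} (hT : T.IsHermitian) (hT1 : (1 - T * T).PosSemidef)
    {Y : Matrix B' B' ℂ} (hY : Y.IsHermitian)
    (htr : (traceSnd (pureState ψ * ((1 : Matrix A A ℂ) ⊗ₖ T))).trace = 0) :
    |(U * (traceSnd (pureState ψ * ((1 : Matrix A A ℂ) ⊗ₖ T)) ⊗ₖ traceSnd ρB) * Uᴴ *
        ((1 : Matrix A' A' ℂ) ⊗ₖ Y)).trace.re| ≤
      2 * (purifiedDistance (pureState ψ) (tensorId RA R (scrambledState U (pureState ψ) ρB)) *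
        √(U * (traceSnd (pureState ψ) ⊗ₖ traceSnd ρB) * Uᴴ *
          ((1 : Matrix A' A' ℂ) ⊗ₖ (Y * Y))).trace.re) := by
  have hψd := isDensity_pureState hψ
  set τ := reorderedFinalState U (pureState ψ) ρB with hτ
  have hτps : τ.PosSemidef := reorderedFinalState_posSemidef U hψd.1 hρB.1
  set ω := (tensorId (RA × B') R (τ.submatrix (Equiv.prodAssoc (A' × RB) RA B').symm
    (Equiv.prodAssoc (A' × RB) RA B').symm)).submatrix (Equiv.prodAssoc A RA B')
      (Equiv.prodAssoc A RA B') with hω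
  have hωps : ω.PosSemidef := (hR.tensorId_posSemidef (hτps.submatrix _)).submatrix _
  have hrec : tensorId RA R (scrambledState U (pureState ψ) ρB) = traceSnd ω :=
    tensorId_traceSnd R τ
  -- The recovery is trace preserving and acts trivially on `R_A B'`, so expectations there agree
  -- before and after it.
  have hexp : ∀ (T : Matrix RA RA ℂ) (Y : Matrix B' B' ℂ),
      (ω * (((1 : Matrix A A ℂ) ⊗ₖ T) ⊗ₖ Y)).trace =
        (U * (traceSnd (pureState ψ * ((1 : Matrix A A ℂ) ⊗ₖ T)) ⊗ₖ traceSnd ρB) * Uᴴ *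
          ((1 : Matrix A' A' ℂ) ⊗ₖ Y)).trace := fun T Y => by
    rw [← trace_reorderedFinalState_mul, ← hτ, ← hR.trace_tensorId_mul, ← Matrix.kronecker_assoc',
      hω, trace_submatrix_equiv_mul]
  have hωtr : ω.trace = 1 := by
    have := hexp 1 1
    simp only [Matrix.one_kronecker_one, mul_one] at this
    rw [this, Matrix.trace_mul_comm, ← Matrix.mul_assoc, hU, Matrix.one_mul,
      Matrix.trace_kronecker, hψd.traceSnd.2, hρB.traceSnd.2, one_mul]
  set P := pureState ψ ⊗ₖ (1 : Matrix B' B' ℂ) with hP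
  have hPP : pureState ψ * pureState ψ = pureState ψ := by
    have := pureState_mul_mul_pureState ψ 1
    rwa [mul_one, hψd.2, one_smul] at this
  have main := abs_re_trace_mul_le hωps
    (T := ((1 : Matrix A A ℂ) ⊗ₖ T) ⊗ₖ (1 : Matrix B' B' ℂ))
    (Y := (1 : Matrix (A × RA) (A × RA) ℂ) ⊗ₖ Y) (P := P)
    (isHermitian_kronecker (isHermitian_kronecker Matrix.isHermitian_one hT)
      Matrix.isHermitian_one)
    (isHermitian_kronecker Matrix.isHermitian_one hY)
    (isHermitian_kronecker hψd.1.isHermitian Matrix.isHermitian_one)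
    (by rw [hP, ← Matrix.mul_kronecker_mul, hPP, mul_one])
    -- The compression of `T` to `ψ` is its mean in `ψ` times the projection, and this mean is zero
    -- by `htr`.
    (by
      rw [hP, ← Matrix.mul_kronecker_mul, ← Matrix.mul_kronecker_mul,
        pureState_mul_mul_pureState, ← trace_traceSnd, htr, zero_smul, Matrix.zero_kronecker])
    (by simp only [hP, ← Matrix.mul_kronecker_mul, mul_one, one_mul])
    (by simp only [← Matrix.mul_kronecker_mul, mul_one, one_mul])
    (by
      have h := (Matrix.PosSemidef.one (n := A) (R := ℂ)).kronecker hT1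
      rw [← one_smul ℂ (1 : Matrix RA RA ℂ), ← neg_sub, ← neg_one_smul ℂ, Matrix.kronecker_smul,
        one_kronecker_sub_smul_one, neg_one_smul, neg_sub, ← mul_one (1 : Matrix A A ℂ),
        Matrix.mul_kronecker_mul] at h
      simpa only [one_smul] using posSemidef_smul_one_sub_sq_kronecker_one (n := B') h)
  -- For the pure target, the squared error is exactly the weight of `ω` outside `P`.
  have hdist : purifiedDistance (pureState ψ)
      (tensorId RA R (scrambledState U (pureState ψ) ρB)) = √(ω * (1 - P)).trace.re := by
    rw [hrec, purifiedDistance_pureState ψ (traceSnd_posSemidef hωps), trace_traceSnd_mul,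
      mul_sub, mul_one, Matrix.trace_sub, hωtr, Complex.sub_re, Complex.one_re]
  have hYY := hexp 1 (Y * Y)
  rw [Matrix.one_kronecker_one, mul_one] at hYY
  rw [hdist, ← hYY, ← hexp]
  simp only [← Matrix.mul_kronecker_mul, mul_one, one_mul] at main
  exact main

end Recovery

end QRecovery

/-! ### The main theorem -/

theorem mainTheorem1
    {A B A' B' RA RB : Type*}
    [Fintype A] [Fintype B] [Fintype A'] [Fintype B'] [Fintype RA] [Fintype RB]
    [DecidableEq A] [DecidableEq B] [DecidableEq A'] [DecidableEq B']
    [DecidableEq RA] [DecidableEq RB]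
    -- the pure initial states of `A R_A` and `B R_B`
    (ψ : EuclideanSpace ℂ (A × RA)) (hψ : ‖ψ‖ = 1)
    (φ : EuclideanSpace ℂ (B × RB)) (hφ : ‖φ‖ = 1)
    -- the unitary operation, read as a unitary from `A B` onto `A' B'`
    (U : Matrix (A' × B') (A × B) ℂ) (hU : Uᴴ * U = 1) (hU' : U * Uᴴ = 1)
    -- the local conserved quantities and the conservation law
    (XA : Matrix A A ℂ) (XB : Matrix B B ℂ) (XA' : Matrix A' A' ℂ) (XB' : Matrix B' B' ℂ)
    (hXA : XA.IsHermitian) (hXB : XB.IsHermitian)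
    (hXA' : XA'.IsHermitian) (hXB' : XB'.IsHermitian)
    (hcons : U * (XA ⊗ₖ (1 : Matrix B B ℂ) + (1 : Matrix A A ℂ) ⊗ₖ XB) * Uᴴ =
      XA' ⊗ₖ (1 : Matrix B' B' ℂ) + (1 : Matrix A' A' ℂ) ⊗ₖ XB') :
    let ρARA := QRecovery.pureState ψ
    let ρBRB := QRecovery.pureState φ
    let ρA := QRecovery.traceSnd ρARA
    let E := QRecovery.evolution U (QRecovery.traceSnd ρBRB)
    let XBRB := XB ⊗ₖ (1 : Matrix RB RB ℂ)
    let fluct := QRecovery.dynamicalFluctuation XA XA' E ρA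
    let F := QRecovery.fisherInfo ρBRB XBRB
    let Δplus := (QRecovery.eigenvalueSpread hXA + QRecovery.eigenvalueSpread hXA') / 2
    let δ := QRecovery.recoveryError U ρARA ρBRB
    -- the maximum, the limit and the minimum in the definitions of `𝒜`, `𝓕` and `δ` exist
    IsGreatest (QRecovery.fluctuations XA XA' E ρA) fluct ∧
    Tendsto (QRecovery.fisherQuotient ρBRB XBRB) (𝓝[≠] 0) (𝓝 F) ∧
    IsLeast (QRecovery.recoveryErrors U ρARA ρBRB) δ ∧
    fluct / (2 * (Real.sqrt F + 4 * Δplus)) ≤ δ := by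
  intro ρARA ρBRB ρA E XBRB fluct F Δplus δ
  have hψd : QRecovery.IsDensity ρARA := QRecovery.isDensity_pureState hψ
  have hφd : QRecovery.IsDensity ρBRB := QRecovery.isDensity_pureState hφ
  have hAd : QRecovery.IsDensity ρA := hψd.traceSnd
  have hBd : QRecovery.IsDensity (QRecovery.traceSnd ρBRB) := hφd.traceSnd
  -- Channels into `A` exist only if its space is nonzero, which the unit trace of `ρ_A` guarantees.
  have : Nonempty A := by
    by_contra h
    rw [not_nonempty_iff] at h
    have : ρA.trace = 0 := by simp [Matrix.trace]
    exact one_ne_zero (hAd.2.symm.trans this)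
  -- existence of the maximum, the limit and the minimum
  obtain ⟨σ, hσ, hσ', hgr⟩ := QRecovery.exists_isGreatest_decomposition hAd
    (QRecovery.meanLoss U (QRecovery.traceSnd ρBRB) XA XA')
  have hfluct : fluct = 2 * (QRecovery.meanLoss U (QRecovery.traceSnd ρBRB) XA XA' σ -
      σ.trace.re * QRecovery.meanLoss U (QRecovery.traceSnd ρBRB) XA XA' ρA) := hgr.csSup_eq
  set b := QRecovery.expect XBRB ρBRB
  set w := QRecovery.weightedNorm ρBRB (XBRB - (b : ℂ) • 1) with hw
  have hlim : Tendsto (QRecovery.fisherQuotient ρBRB XBRB) (𝓝[≠] 0) (𝓝 (4 * w ^ 2)) :=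
    QRecovery.tendsto_fisherQuotient_pureState hφ
      (QRecovery.isHermitian_kronecker hXB Matrix.isHermitian_one)
  have hF : F = 4 * w ^ 2 := hlim.limUnder_eq
  obtain ⟨d, hd⟩ : ∃ d, IsLeast (QRecovery.recoveryErrors U ρARA ρBRB) d :=
    QRecovery.exists_isLeast_recovery ψ
      (QRecovery.traceSnd_posSemidef (QRecovery.reorderedFinalState_posSemidef U hψd.1 hφd.1))
  have hδ : δ = d := hd.csInf_eq
  refine ⟨by rw [hfluct]; exact hgr, by rw [hF]; exact hlim, by rw [hδ]; exact hd, ?_⟩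
  rw [hδ]
  obtain ⟨⟨R, hR, hdR⟩, -⟩ := hd
  have hd0 : 0 ≤ d := hdR ▸ Real.sqrt_nonneg _
  have hw0 : 0 ≤ w := QRecovery.weightedNorm_nonneg _ _
  have hΔ0 : 0 ≤ Δplus := div_nonneg (add_nonneg (QRecovery.eigenvalueSpread_nonneg hXA)
    (QRecovery.eigenvalueSpread_nonneg hXA')) two_pos.le
  have hsqrt : Real.sqrt F = 2 * w := by
    rw [hF, show 4 * w ^ 2 = (2 * w) ^ 2 by ring, Real.sqrt_sq (by positivity)]
  -- the optimal part `σ` of `ρ_A` corresponds to an effect `S` on `R_A`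
  set M : Matrix A RA ℂ := Matrix.of fun a r => ψ (a, r) with hM
  have hρM : ρA = M * Mᴴ := by
    have := QRecovery.traceSnd_pureState_mul ψ 1
    rwa [Matrix.one_kronecker_one, mul_one, Matrix.transpose_one, Matrix.mul_one] at this
  obtain ⟨S, hS, hS', hσS⟩ := QRecovery.exists_eq_mul_mul_conjTranspose (M := M) hσ
    (by rwa [← hρM])
  set s := σ.trace.re with hs
  have hσ0 := Complex.nonneg_iff.1 hσ.trace_nonneg
  have hs1 : s ≤ 1 := by
    have := (Complex.nonneg_iff.1 hσ'.trace_nonneg).1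
    rw [Matrix.trace_sub, hAd.2, Complex.sub_re, Complex.one_re] at this
    linarith
  have hstr : σ.trace = (s : ℂ) := Complex.ext rfl hσ0.2.symm
  -- Subtracting `s` makes the mean in `ψ` vanish. As `0 ≤ S ≤ 1` and `0 ≤ s ≤ 1`, the result is
  -- still a contraction.
  set T₀ := S - (s : ℂ) • (1 : Matrix RA RA ℂ) with hT₀
  have hT₀T : QRecovery.traceSnd (ρARA * ((1 : Matrix A A ℂ) ⊗ₖ T₀ᵀ)) = σ - (s : ℂ) • ρA := by
    rw [QRecovery.traceSnd_pureState_mul, Matrix.transpose_transpose, ← hM, hT₀, hρM, hσS,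
      Matrix.mul_sub, Matrix.sub_mul, Matrix.mul_smul, Matrix.smul_mul, Matrix.mul_one]
  have hT₀tr : (σ - (s : ℂ) • ρA).trace = 0 := by
    rw [Matrix.trace_sub, Matrix.trace_smul, hAd.2, hstr, smul_eq_mul, mul_one, sub_self]
  have hT₀h : T₀.IsHermitian := QRecovery.isHermitian_sub_real_smul_one hS.isHermitian s
  have hT₀1 : (1 - T₀ᵀ * T₀ᵀ).PosSemidef := by
    have h₁ : (1 - T₀).PosSemidef := by
      have := hS'.add (Matrix.PosSemidef.one.smul (n := RA) (a := (s : ℂ))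
        (by exact_mod_cast hσ0.1))
      rwa [sub_add] at this
    have h₂ : (1 + T₀).PosSemidef := by
      have := hS.add (Matrix.PosSemidef.one.smul (n := RA) (a := ((1 - s : ℝ) : ℂ))
        (by exact_mod_cast sub_nonneg.2 hs1))
      convert this using 1
      rw [hT₀]
      push_cast
      module
    have := (QRecovery.posSemidef_one_sub_sq h₁ h₂).transpose
    rwa [Matrix.transpose_sub, Matrix.transpose_one, Matrix.transpose_mul] at this
  -- Centring at the mean `b` of `X_B` makes the first term of the bound the standard deviation `w =
  -- √𝓕 / 2`.
  obtain ⟨y, hy⟩ := QRecovery.exists_sqrt_trace_le hU hU' hXA hXA' hXB' hcons hAd hφd b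
  have hkey := QRecovery.abs_re_trace_le_purifiedDistance hψ hφd hU hR hT₀h.transpose hT₀1
    (QRecovery.isHermitian_sub_real_smul_one hXB' y) (hT₀T ▸ hT₀tr)
  rw [hT₀T, ← QRecovery.meanLoss_eq_of_trace_eq_zero hU hcons hBd.2 hT₀tr] at hkey
  change _ ≤ 2 * (QRecovery.purifiedDistance ρARA (QRecovery.tensorId RA R
    (QRecovery.scrambledState U ρARA ρBRB)) * _) at hkey
  rw [← hdR] at hkey
  have hfluct' : fluct = 2 * QRecovery.meanLoss U (QRecovery.traceSnd ρBRB) XA XA'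
      (σ - (s : ℂ) • ρA) := by
    rw [hfluct, map_sub, Complex.coe_smul, map_smul, smul_eq_mul]
  have hbound : fluct ≤ 4 * (d * (w + Δplus)) := by
    have h1 := (le_abs_self _).trans hkey
    have h2 : _ ≤ d * (w + Δplus) := mul_le_mul_of_nonneg_left hy hd0
    rw [hfluct']
    change _ ≤ 2 * (d * _) at h1
    calc _ ≤ 2 * (2 * _) := mul_le_mul_of_nonneg_left h1 two_pos.le
      _ ≤ 2 * (2 * (d * (w + Δplus))) := by gcongr
      _ = _ := by ring
  rw [hsqrt]
  -- A vanishing denominator is covered because division by zero gives `0 ≤ d`. The bound has `2 Δ₊`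
  -- to spare beside `√𝓕`.
  refine div_le_of_le_mul₀ (by positivity) hd0 ?_
  nlinarith [mul_nonneg hd0 hΔ0]
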